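/- Let $X$ be a complex Banach space and $T\in L(X)$ a bounded operator with spectrum $\sigma(T)$; write $\mathrm{acc}\,A$ and $\mathrm{iso}\,A$ for the sets of accumulation points and of isolated points of $A\subset\mathbb{C}$. Call $\sigma\subset\sigma(T)$ a spectral set of $T$ if $\sigma$ and $\sigma(T)\setminus\sigma$ are closed, and let $P_\sigma=\frac{1}{2\pi i}\int_\Gamma(\lambda I-T)^{-1}\,d\lambda$ be the associated spectral projection, where $\Gamma$ is any contour surrounding $\sigma$ and separating it from $\sigma(T)\setminus\sigma$. Call $S\in L(X)$ a $g_z$-inverse of $T$ if $S$ is Drazin invertible, $TS=ST$, $STS=S$ and $\mathrm{acc}\,\sigma(T^2S-T)\subset\{0\}$. Suppose that $0\in\sigma(T)\setminus\mathrm{acc}(\mathrm{acc}\,\sigma(T))$, and let $\sigma$ be a spectral set of $T$ with $0\in\sigma$ and $\sigma\setminus\{0\}\subset\mathrm{iso}\,\sigma(T)$. Let $r\in\mathbb{C}$ with $|r|>\max_{\lambda\in\sigma}|\lambda|$. Then $P_\sigma$ is well defined, $T+rP_\sigma$ is invertible, and $$T^D_\sigma:=(T+rP_\sigma)^{-1}(I-P_\sigma)$$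 is a $g_z$-inverse of $T$ (the $g_z$-inverse of $T$ associated to $\sigma$). There are functions $f_\sigma$, holomorphic on an open neighbourhood of $\sigma(T)$, such that $f_\sigma=0$ in a neighbourhood of $\sigma$ and $f_\sigma(\lambda)=\frac1\lambda$ in a neighbourhood of $\sigma(T)\setminus\sigma$, and for every such function $$T^D_\sigma=f_\sigma(T)$$ in the sense of the holomorphic functional calculus, $f_\sigma(T)=\frac{1}{2\pi i}\int_\Gamma f_\sigma(\lambda)(\lambda I-T)^{-1}\,d\lambda$ with $\Gamma$ any contour surrounding $\sigma(T)$ in the domain of $f_\sigma$. Moreover $$\sigma(T^D_\sigma)=\{0\}\cup\{\lambda^{-1}:\lambda\in\sigma(T)\setminus\sigma\}.$$ -/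

import Mathlib

open Set Filter Topology

noncomputable section

/-- A (piecewise `C¹`) `1`-cycle in the plane: finitely many `C¹` curves on `[0, 1]` whose initial
points and terminal points agree as multisets. For example, the consecutive `C¹` pieces of finitely
many closed piecewise `C¹` curves, or the oriented boundary of a bounded domain with piecewise `C¹` boundary. -/
structure PlaneCycle where
  n : ℕ
  path : Fin n → ℝ → ℂ
  contDiffOn : ∀ i, ContDiffOn ℝ 1 (path i) (Icc 0 1)
  closed : (Finset.univ.val.map fun i => path i 0) = Finset.univ.val.map fun i => path i 1

namespace PlaneCycle

/-- The set of points on the curves of the cycle. -/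
def trace (Γ : PlaneCycle) : Set ℂ := ⋃ i, Γ.path i '' Icc 0 1

/-- The contour integral `∫_Γ F(z) dz` of a vector-valued function. -/
def integral {E : Type*} [NormedAddCommGroup E] [NormedSpace ℂ E] (Γ : PlaneCycle) (F : ℂ → E) :
    E :=
  ∑ i, ∫ t in (0 : ℝ)..1, derivWithin (Γ.path i) (Icc 0 1) t • F (Γ.path i t)

/-- The index (winding number) of the cycle around a point off its trace. -/
def index (Γ : PlaneCycle) (a : ℂ) : ℂ :=
  (2 * Real.pi * Complex.I)⁻¹ * Γ.integral fun z => (z - a)⁻¹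

/-- `Γ` surrounds `K` in `U`: it runs in `U \ K`, winds once around every point of `K`, and does
not wind around any point outside `U`. -/
def Surrounds (Γ : PlaneCycle) (K U : Set ℂ) : Prop :=
  Γ.trace ⊆ U \ K ∧ (∀ z ∈ K, Γ.index z = 1) ∧ ∀ z ∉ U, Γ.index z = 0

end PlaneCycle

section Operators

variable {X : Type*} [NormedAddCommGroup X] [NormedSpace ℂ X]

/-- `A` is the value of `(2πi)⁻¹ ∫_Γ f(z) (zI - T)⁻¹ dz` over the contours `Γ` surrounding `K`
in `U`: such contours exist, and each of them gives the value `A`. -/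
def IsRieszIntegral (T : X →L[ℂ] X) (K U : Set ℂ) (f : ℂ → ℂ) (A : X →L[ℂ] X) : Prop :=
  (∃ Γ : PlaneCycle, Γ.Surrounds K U) ∧
    ∀ Γ : PlaneCycle, Γ.Surrounds K U →
      (2 * Real.pi * Complex.I : ℂ)⁻¹ • Γ.integral (fun z => f z • resolvent T z) = A

open Classical in
/-- The common value of `(2πi)⁻¹ ∫_Γ f(z) (zI - T)⁻¹ dz` over all contours `Γ` surrounding `K`
in `U` (and `0` if there is no such value). -/
def rieszIntegral (T : X →L[ℂ] X) (K U : Set ℂ) (f : ℂ → ℂ) : X →L[ℂ] X :=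
  if h : ∃ A, IsRieszIntegral T K U f A then h.choose else 0

/-- The operator `f(T)` of the holomorphic functional calculus, for `f` holomorphic on an open set
`U` containing the spectrum of `T`. -/
def holFunCalc (T : X →L[ℂ] X) (U : Set ℂ) (f : ℂ → ℂ) : X →L[ℂ] X :=
  rieszIntegral T (spectrum ℂ T) U f

/-- `σ` is a spectral set of `T`: a subset of the spectrum such that `σ` and `σ(T) \ σ` are
closed. -/
def IsSpectralSet (T : X →L[ℂ] X) (σ : Set ℂ) : Prop :=
  σ ⊆ spectrum ℂ T ∧ IsClosed σ ∧ IsClosed (spectrum ℂ T \ σ)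

/-- The spectral projection `P_σ = (2πi)⁻¹ ∫_Γ (zI - T)⁻¹ dz` of `T` associated with a spectral
set `σ`; the contour surrounds `σ` and separates it from the rest of the spectrum. -/
def spectralProjection (T : X →L[ℂ] X) (σ : Set ℂ) : X →L[ℂ] X :=
  rieszIntegral T σ (spectrum ℂ T \ σ)ᶜ fun _ => 1

/-- The operator `(T + r P_σ)⁻¹ (I - P_σ)`. -/
def spectralGzInverse (T : X →L[ℂ] X) (σ : Set ℂ) (r : ℂ) : X →L[ℂ] X :=
  Ring.inverse (T + r • spectralProjection T σ) * (1 - spectralProjection T σ)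

/-- The isolated points of a subset of the plane. -/
def isoPoints (A : Set ℂ) : Set ℂ := A \ derivedSet A

/-- `T` is zeroloid: its spectrum has no accumulation point other than `0`. -/
def IsZeroloid (T : X →L[ℂ] X) : Prop := derivedSet (spectrum ℂ T) ⊆ {0}

/-- `T` is Drazin invertible. -/
def IsDrazinInvertible (T : X →L[ℂ] X) : Prop :=
  ∃ S : X →L[ℂ] X, S * T = T * S ∧ S * T * S = S ∧ ∃ n : ℕ, T ^ n * S * T = T ^ n

/-- `S` is a `g_z`-inverse of `T`. -/
def IsGzInverse (T S : X →L[ℂ] X) : Prop :=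
  IsDrazinInvertible S ∧ T * S = S * T ∧ S * T * S = S ∧ IsZeroloid (T ^ 2 * S - T)

/-- `f` is holomorphic on the open neighbourhood `U` of the spectrum of `T`, vanishes near `σ`, and
equals `1 / z` near the rest of the spectrum. -/
def IsReciprocalOff (T : X →L[ℂ] X) (σ U : Set ℂ) (f : ℂ → ℂ) : Prop :=
  IsOpen U ∧ spectrum ℂ T ⊆ U ∧ DifferentiableOn ℂ f U ∧
    (∀ᶠ z in 𝓝ˢ σ, f z = 0) ∧ ∀ᶠ z in 𝓝ˢ (spectrum ℂ T \ σ), f z = 1 / z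

end Operators

end

/-!
The holomorphic functional calculus `f ↦ f(T)` turns every claim into an identity between functions
near the spectrum. If `χ` is `1` near `σ` and `0` near the rest of the spectrum, then `P_σ = χ(T)`,
because a cycle around `σ` together with one around the rest surrounds the whole spectrum. Since
`(z + r χ) f_σ = 1 - χ` near the spectrum and `z + r χ` has no zero on it, the operator
`(T + r P_σ)⁻¹ (1 - P_σ)` is `f_σ(T)`. It is a `g_z`-inverse because `f_σ z f_σ = f_σ`, and
`z² f_σ - z` maps the spectrum into `-σ ∪ {0}`.

Multiplicativity of the calculus comes from the difference quotient
`g_z(w) = (g(z) - g(w)) / (z - w)`: as `(z - a) g_z(a) = g(z) - g(a)`, the integral defining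
`(f g)(a) - f(a) g(a)` has the integrand `f(z) g_z(a)`, and writing `g_z(a)` as an integral over a
second cycle and exchanging the two integrals makes it vanish by Cauchy's theorem. The value
`1(a) = 1` comes from the substitution `z ↦ 1 / z`.

Cauchy's theorem for a cycle that does not wind around points outside `U` reduces to one good cycle
per compact set, namely the boundary of a union of grid squares. There the Cauchy formula holds by
the theorem for rectangles; inserting it into an integral over any other cycle and exchanging the
integrals replaces the kernel `(z - w)⁻¹` by the index.
-/

noncomputable section

namespace PlaneCycle

variable {E : Type*} [NormedAddCommGroup E] [NormedSpace ℂ E]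

/-! ### Integrals over cycles -/

section Integral

variable (Γ : PlaneCycle)

theorem path_mem_trace (i : Fin Γ.n) {t : ℝ} (ht : t ∈ Icc (0 : ℝ) 1) : Γ.path i t ∈ Γ.trace :=
  mem_iUnion.2 ⟨i, mem_image_of_mem _ ht⟩

theorem mapsTo_path (i : Fin Γ.n) : MapsTo (Γ.path i) (Icc 0 1) Γ.trace :=
  fun _ ht => Γ.path_mem_trace i ht

theorem isCompact_trace : IsCompact Γ.trace :=
  isCompact_iUnion fun i => isCompact_Icc.image_of_continuousOn (Γ.contDiffOn i).continuousOn

theorem continuousOn_derivWithin_path (i : Fin Γ.n) :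
    ContinuousOn (derivWithin (Γ.path i) (Icc 0 1)) (Icc 0 1) :=
  (Γ.contDiffOn i).continuousOn_derivWithin (uniqueDiffOn_Icc zero_lt_one) le_rfl

theorem hasDerivAt_path (i : Fin Γ.n) {t : ℝ} (ht : t ∈ Ioo (0 : ℝ) 1) :
    HasDerivAt (Γ.path i) (derivWithin (Γ.path i) (Icc 0 1) t) t :=
  ((Γ.contDiffOn i).differentiableOn one_ne_zero t
    (Ioo_subset_Icc_self ht)).hasDerivWithinAt.hasDerivAt (Icc_mem_nhds ht.1 ht.2)

variable {Γ}

theorem intervalIntegrable_integrand {f : ℂ → E} (hf : ContinuousOn f Γ.trace) (i : Fin Γ.n) :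
    IntervalIntegrable (fun t => derivWithin (Γ.path i) (Icc 0 1) t • f (Γ.path i t))
      MeasureTheory.volume 0 1 := by
  refine ContinuousOn.intervalIntegrable ?_
  rw [uIcc_of_le zero_le_one]
  exact (Γ.continuousOn_derivWithin_path i).smul
    (hf.comp (Γ.contDiffOn i).continuousOn (Γ.mapsTo_path i))

theorem integral_congr {f g : ℂ → E} (h : EqOn f g Γ.trace) : Γ.integral f = Γ.integral g := by
  refine Finset.sum_congr rfl fun i _ => intervalIntegral.integral_congr fun t ht => ?_
  rw [uIcc_of_le zero_le_one] at ht
  simp only [h (Γ.path_mem_trace i ht)]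

theorem integral_add {f g : ℂ → E} (hf : ContinuousOn f Γ.trace) (hg : ContinuousOn g Γ.trace) :
    Γ.integral (fun z => f z + g z) = Γ.integral f + Γ.integral g := by
  simp only [integral, smul_add, ← Finset.sum_add_distrib]
  exact Finset.sum_congr rfl fun i _ => intervalIntegral.integral_add
    (intervalIntegrable_integrand hf i) (intervalIntegrable_integrand hg i)

theorem integral_const_smul (c : ℂ) (f : ℂ → E) :
    Γ.integral (fun z => c • f z) = c • Γ.integral f := by
  simp only [integral, Finset.smul_sum, ← intervalIntegral.integral_smul, smul_comm c]

theorem integral_sub {f g : ℂ → E} (hf : ContinuousOn f Γ.trace) (hg : ContinuousOn g Γ.trace) :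
    Γ.integral (fun z => f z - g z) = Γ.integral f - Γ.integral g := by
  simp only [integral, smul_sub, ← Finset.sum_sub_distrib]
  exact Finset.sum_congr rfl fun i _ => intervalIntegral.integral_sub
    (intervalIntegrable_integrand hf i) (intervalIntegrable_integrand hg i)

theorem integral_clm [CompleteSpace E] {F : Type*} [NormedAddCommGroup F] [NormedSpace ℂ F]
    [CompleteSpace F] (L : E →L[ℂ] F) {f : ℂ → E} (hf : ContinuousOn f Γ.trace) :
    Γ.integral (fun z => L (f z)) = L (Γ.integral f) := by
  simp only [integral, map_sum,
    ← L.intervalIntegral_comp_comm (intervalIntegrable_integrand hf _), map_smul]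

theorem integral_smul_const [CompleteSpace E] (f : ℂ → ℂ) (v : E) :
    Γ.integral (fun z => f z • v) = Γ.integral f • v := by
  simp only [integral, Finset.sum_smul, ← intervalIntegral.integral_smul_const, smul_assoc]

theorem integral_eq_zero_of_hasDerivAt [CompleteSpace E] {f g : ℂ → E}
    (hg : ∀ z ∈ Γ.trace, HasDerivAt g (f z) z) (hf : ContinuousOn f Γ.trace) :
    Γ.integral f = 0 := by
  have hg_cont : ContinuousOn g Γ.trace := HasDerivAt.continuousOn hg
  have integral_path (i : Fin Γ.n) :
      ∫ t in (0 : ℝ)..1, derivWithin (Γ.path i) (Icc 0 1) t • f (Γ.path i t) =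
        g (Γ.path i 1) - g (Γ.path i 0) :=
    intervalIntegral.integral_eq_sub_of_hasDerivAt_of_le zero_le_one
      (hg_cont.comp (Γ.contDiffOn i).continuousOn (Γ.mapsTo_path i))
      (fun t ht => (hg _ (Γ.path_mem_trace i (Ioo_subset_Icc_self ht))).scomp t
        (Γ.hasDerivAt_path i ht))
      (intervalIntegrable_integrand hf i)
  have sum_endpoints : ∑ i, g (Γ.path i 0) = ∑ i, g (Γ.path i 1) := by
    have h := congrArg (fun s : Multiset ℂ => (s.map g).sum) Γ.closed
    simp only [Multiset.map_map] at h
    exact h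
  simp only [integral, integral_path, Finset.sum_sub_distrib, sum_endpoints, sub_self]

theorem integrableOn_integrand_prod {Γ' : PlaneCycle} {f : ℂ → ℂ → E}
    (hf : ContinuousOn (fun p : ℂ × ℂ => f p.1 p.2) (Γ.trace ×ˢ Γ'.trace))
    (i : Fin Γ.n) (j : Fin Γ'.n) :
    MeasureTheory.IntegrableOn (fun p : ℝ × ℝ =>
      derivWithin (Γ.path i) (Icc 0 1) p.1 • derivWithin (Γ'.path j) (Icc 0 1) p.2 •
        f (Γ.path i p.1) (Γ'.path j p.2))
      (Ioc 0 1 ×ˢ Ioc 0 1) (MeasureTheory.volume.prod MeasureTheory.volume) := by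
  refine (ContinuousOn.integrableOn_compact (K := Icc 0 1 ×ˢ Icc 0 1)
    (isCompact_Icc.prod isCompact_Icc) ?_).mono_set
      (prod_mono Ioc_subset_Icc_self Ioc_subset_Icc_self)
  refine ((Γ.continuousOn_derivWithin_path i).comp continuousOn_fst fun p hp => hp.1).smul
    (((Γ'.continuousOn_derivWithin_path j).comp continuousOn_snd fun p hp => hp.2).smul ?_)
  exact hf.comp ((Γ.contDiffOn i).continuousOn.prodMap (Γ'.contDiffOn j).continuousOn)
    ((Γ.mapsTo_path i).prodMap (Γ'.mapsTo_path j))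

theorem integral_integral_eq_sum {Γ' : PlaneCycle} {f : ℂ → ℂ → E}
    (hf : ContinuousOn (fun p : ℂ × ℂ => f p.1 p.2) (Γ.trace ×ˢ Γ'.trace)) :
    Γ.integral (fun z => Γ'.integral fun w => f z w) = ∑ i, ∑ j, ∫ t in (0 : ℝ)..1,
      ∫ s in (0 : ℝ)..1, derivWithin (Γ.path i) (Icc 0 1) t •
      derivWithin (Γ'.path j) (Icc 0 1) s • f (Γ.path i t) (Γ'.path j s) := by
  refine Finset.sum_congr rfl fun i _ => ?_
  rw [← intervalIntegral.integral_finsetSum]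
  · simp only [integral, Finset.smul_sum, intervalIntegral.integral_smul]
  · intro j _
    have h := integrableOn_integrand_prod hf i j
    rw [MeasureTheory.IntegrableOn, ← MeasureTheory.Measure.prod_restrict] at h
    simp only [intervalIntegrable_iff, uIoc_of_le (zero_le_one' ℝ),
      intervalIntegral.integral_of_le (zero_le_one' ℝ)]
    exact h.integral_prod_left

theorem integral_integral_swap {Γ' : PlaneCycle} {f : ℂ → ℂ → E}
    (hf : ContinuousOn (fun p : ℂ × ℂ => f p.1 p.2) (Γ.trace ×ˢ Γ'.trace)) :
    Γ.integral (fun z => Γ'.integral fun w => f z w) =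
      Γ'.integral fun w => Γ.integral fun z => f z w := by
  have hf_swap : ContinuousOn (fun p : ℂ × ℂ => f p.2 p.1) (Γ'.trace ×ˢ Γ.trace) :=
    hf.comp continuous_swap.continuousOn fun p hp => ⟨hp.2, hp.1⟩
  rw [integral_integral_eq_sum hf, integral_integral_eq_sum (f := fun w z => f z w) hf_swap,
    Finset.sum_comm]
  refine Finset.sum_congr rfl fun j _ => Finset.sum_congr rfl fun i _ => ?_
  rw [MeasureTheory.intervalIntegral_intervalIntegral_swap]
  · simp only [smul_comm (derivWithin (Γ.path i) (Icc 0 1) _)]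
  · rw [uIoc_of_le (zero_le_one' ℝ)]
    exact integrableOn_integrand_prod hf i j

end Integral

/-! ### The index -/

section Index

variable {Γ : PlaneCycle} {a b : ℂ}

theorem continuousOn_sub_inv {s : Set ℂ} (ha : a ∉ s) : ContinuousOn (fun z => (z - a)⁻¹) s :=
  (continuousOn_id.sub continuousOn_const).inv₀ fun _ hz =>
    sub_ne_zero.2 (ne_of_mem_of_not_mem hz ha)

theorem integral_sub_inv (Γ : PlaneCycle) (a : ℂ) :
    Γ.integral (fun z => (z - a)⁻¹) = (2 * Real.pi * Complex.I) * Γ.index a := by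
  rw [index, mul_inv_cancel_left₀ Complex.two_pi_I_ne_zero]

theorem integral_div_eq_zero_of_mapsTo_slitPlane {g g' : ℂ → ℂ}
    (hg : ∀ z ∈ Γ.trace, HasDerivAt g (g' z) z) (hg' : ContinuousOn g' Γ.trace)
    (hslit : MapsTo g Γ.trace Complex.slitPlane) : Γ.integral (fun z => g' z / g z) = 0 :=
  integral_eq_zero_of_hasDerivAt (fun z hz => (hg z hz).clog (hslit hz))
    (hg'.div (HasDerivAt.continuousOn hg) fun _ hz => Complex.slitPlane_ne_zero (hslit hz))

theorem index_eq_of_norm_sub_lt (h : ∀ z ∈ Γ.trace, ‖b - a‖ < ‖z - a‖) :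
    Γ.index b = Γ.index a := by
  have hza (z) (hz : z ∈ Γ.trace) : z - a ≠ 0 := norm_pos_iff.1 ((norm_nonneg _).trans_lt (h z hz))
  have hzb (z) (hz : z ∈ Γ.trace) : z - b ≠ 0 := fun h0 =>
    (h z hz).ne (by rw [sub_eq_zero.1 h0])
  have hslit : MapsTo (fun z => (z - b) / (z - a)) Γ.trace Complex.slitPlane := fun z hz => by
    have hdiv : (z - b) / (z - a) = 1 + -((b - a) / (z - a)) := by
      have := hza z hz
      field_simp
      ring
    simp only [hdiv]
    refine Complex.mem_slitPlane_of_norm_lt_one ?_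
    rw [norm_neg, norm_div, div_lt_one (norm_pos_iff.2 (hza z hz))]
    exact h z hz
  have hzero := integral_div_eq_zero_of_mapsTo_slitPlane
    (fun z hz => ((hasDerivAt_id z).sub_const b).div ((hasDerivAt_id z).sub_const a) (hza z hz))
    (by
      simp only [id]
      exact ContinuousOn.div (by fun_prop) (by fun_prop) fun z hz => pow_ne_zero 2 (hza z hz))
    hslit
  have hlog : EqOn (fun z => (z - b)⁻¹ - (z - a)⁻¹)
      (fun z => (1 * (z - a) - (z - b) * 1) / (z - a) ^ 2 / ((z - b) / (z - a))) Γ.trace :=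
    fun z hz => by
      have := hza z hz
      have := hzb z hz
      simp only
      field_simp
  rw [index, index, ← sub_eq_zero, ← mul_sub, ← integral_sub, integral_congr hlog]
  · exact mul_eq_zero_of_right _ hzero
  · exact continuousOn_sub_inv fun hb => hzb b hb (sub_self b)
  · exact continuousOn_sub_inv fun ha => hza a ha (sub_self a)

theorem index_eventuallyEq (ha : a ∉ Γ.trace) : ∀ᶠ b in 𝓝 a, Γ.index b = Γ.index a := by
  obtain ⟨ε, hε, h⟩ := Metric.isOpen_iff.1 Γ.isCompact_trace.isClosed.isOpen_compl a ha
  filter_upwards [Metric.ball_mem_nhds a hε] with b hb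
  refine index_eq_of_norm_sub_lt fun z hz => ?_
  have hz_far : ε ≤ dist z a := not_lt.1 fun hlt => h hlt hz
  rw [← dist_eq_norm, ← dist_eq_norm]
  exact (Metric.mem_ball.1 hb).trans_le hz_far

theorem index_eq_of_isPreconnected {s : Set ℂ} (hs : IsPreconnected s) (hdisj : Disjoint s Γ.trace)
    (ha : a ∈ s) (hb : b ∈ s) : Γ.index a = Γ.index b :=
  hs.induction₂ (fun x y => Γ.index x = Γ.index y)
    (fun _ hx => nhdsWithin_le_nhds <|
      (index_eventuallyEq (disjoint_left.1 hdisj hx)).mono fun _ => Eq.symm)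
    (fun _ _ _ _ _ _ => Eq.trans) (fun _ _ _ _ => Eq.symm) ha hb

theorem index_eq_zero_of_re_pos {k : ℂ} (h : ∀ z ∈ Γ.trace, 0 < ((z - a) * k).re) :
    Γ.index a = 0 := by
  have hzero := integral_div_eq_zero_of_mapsTo_slitPlane
    (fun z _ => ((hasDerivAt_id z).sub_const a).mul_const k) continuousOn_const
    fun z hz => Complex.mem_slitPlane_iff.2 (Or.inl (h z hz))
  refine mul_eq_zero_of_right _ (Eq.trans (integral_congr fun z hz => ?_) hzero)
  have hk : k ≠ 0 := fun hk => (h z hz).ne' (by simp [hk])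
  rw [one_mul, id, mul_comm, div_mul_cancel_left₀ hk]

theorem index_eq_zero_of_norm_lt (h : ∀ z ∈ Γ.trace, ‖z‖ < ‖a‖) : Γ.index a = 0 := by
  refine index_eq_zero_of_re_pos (k := -(starRingEnd ℂ) a) fun z hz => ?_
  have hre : (z * (starRingEnd ℂ) a).re < (a * (starRingEnd ℂ) a).re :=
    calc (z * (starRingEnd ℂ) a).re ≤ ‖z * (starRingEnd ℂ) a‖ := Complex.re_le_norm _
      _ = ‖z‖ * ‖a‖ := by rw [norm_mul, RCLike.norm_conj]
      _ < ‖a‖ * ‖a‖ := by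
        gcongr
        exacts [(norm_nonneg z).trans_lt (h z hz), h z hz]
      _ = (a * (starRingEnd ℂ) a).re := by
        rw [Complex.mul_conj, Complex.ofReal_re, Complex.normSq_eq_norm_sq, sq]
  rw [mul_neg, sub_mul, Complex.neg_re, Complex.sub_re]
  linarith

end Index

/-! ### Cycles from finite families of curves -/

section Construct

/-- The cycle formed by a finite family of curves with an arbitrary index type. -/
def ofFintype {ι : Type*} [Fintype ι] (p : ι → ℝ → ℂ) (hp : ∀ i, ContDiffOn ℝ 1 (p i) (Icc 0 1))
    (hc : (Finset.univ.val.map fun i => p i 0) = Finset.univ.val.map fun i => p i 1) :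
    PlaneCycle where
  n := Fintype.card ι
  path k := p ((Fintype.equivFin ι).symm k)
  contDiffOn k := hp _
  closed := by
    have map_univ_symm (g : ι → ℂ) :
        (Finset.univ.val.map fun k => g ((Fintype.equivFin ι).symm k)) =
          Finset.univ.val.map g := by
      rw [← Finset.map_univ_equiv (Fintype.equivFin ι).symm, Finset.map_val, Multiset.map_map]
      rfl
    rw [map_univ_symm fun i => p i 0, map_univ_symm fun i => p i 1, hc]

variable {ι : Type*} [Fintype ι] {p : ι → ℝ → ℂ} {hp : ∀ i, ContDiffOn ℝ 1 (p i) (Icc 0 1)}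
    {hc : (Finset.univ.val.map fun i => p i 0) = Finset.univ.val.map fun i => p i 1}

theorem trace_ofFintype : (ofFintype p hp hc).trace = ⋃ i, p i '' Icc 0 1 :=
  (Fintype.equivFin ι).symm.surjective.iUnion_comp fun i => p i '' Icc 0 1

theorem integral_ofFintype (f : ℂ → E) : (ofFintype p hp hc).integral f =
    ∑ i, ∫ t in (0 : ℝ)..1, derivWithin (p i) (Icc 0 1) t • f (p i t) :=
  (Fintype.equivFin ι).symm.sum_comp fun i =>
    ∫ t in (0 : ℝ)..1, derivWithin (p i) (Icc 0 1) t • f (p i t)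

/-- The sum of two cycles. -/
def append (Γ Γ' : PlaneCycle) : PlaneCycle :=
  ofFintype (Sum.elim Γ.path Γ'.path) (by rintro (i | i); exacts [Γ.contDiffOn i, Γ'.contDiffOn i])
    (by
      have map_univ_sum (g : Fin Γ.n ⊕ Fin Γ'.n → ℂ) : Finset.univ.val.map g =
          (Finset.univ.val.map fun i => g (Sum.inl i)) +
            Finset.univ.val.map fun i => g (Sum.inr i) := by
        rw [← Finset.univ_disjSum_univ, Finset.val_disjSum, Multiset.disjSum, Multiset.map_add,
          Multiset.map_map, Multiset.map_map]
        rfl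
      simp only [map_univ_sum, Sum.elim_inl, Sum.elim_inr, Γ.closed, Γ'.closed])

theorem trace_append (Γ Γ' : PlaneCycle) : (Γ.append Γ').trace = Γ.trace ∪ Γ'.trace := by
  rw [append, trace_ofFintype, iUnion_sum]
  rfl

theorem integral_append (Γ Γ' : PlaneCycle) (f : ℂ → E) :
    (Γ.append Γ').integral f = Γ.integral f + Γ'.integral f := by
  rw [append, integral_ofFintype, Fintype.sum_sum_type]
  rfl

theorem index_append (Γ Γ' : PlaneCycle) (a : ℂ) :
    (Γ.append Γ').index a = Γ.index a + Γ'.index a := by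
  rw [index, integral_append, mul_add, index, index]

end Construct

section Surrounds

variable {Γ Γ₁ Γ₂ : PlaneCycle} {K K' K₁ K₂ U U' V₁ V₂ : Set ℂ}

theorem Surrounds.mono (h : Γ.Surrounds K U) (hK : K' ⊆ K) (hU : U ⊆ U') : Γ.Surrounds K' U' :=
  ⟨h.1.trans (sdiff_subset_sdiff hU hK), fun z hz => h.2.1 z (hK hz),
    fun z hz => h.2.2 z fun hzU => hz (hU hzU)⟩

theorem Surrounds.append (h₁ : Γ₁.Surrounds K₁ V₁) (h₂ : Γ₂.Surrounds K₂ V₂) (hK₁ : K₁ ⊆ V₁)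
    (hK₂ : K₂ ⊆ V₂) (hV : Disjoint V₁ V₂) : (Γ₁.append Γ₂).Surrounds (K₁ ∪ K₂) (V₁ ∪ V₂) := by
  refine ⟨?_, ?_, ?_⟩
  · rw [trace_append]
    rintro z (hz | hz)
    · exact ⟨Or.inl (h₁.1 hz).1, fun hzK => hzK.elim (h₁.1 hz).2
        fun hz₂ => disjoint_left.1 hV (h₁.1 hz).1 (hK₂ hz₂)⟩
    · exact ⟨Or.inr (h₂.1 hz).1, fun hzK => hzK.elim
        (fun hz₁ => disjoint_left.1 hV (hK₁ hz₁) (h₂.1 hz).1) (h₂.1 hz).2⟩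
  · rintro z (hz | hz)
    · rw [index_append, h₁.2.1 z hz, h₂.2.2 z (disjoint_left.1 hV (hK₁ hz)), add_zero]
    · rw [index_append, h₂.2.1 z hz, h₁.2.2 z (disjoint_right.1 hV (hK₂ hz)), zero_add]
  · intro z hz
    rw [index_append, h₁.2.2 z fun hz₁ => hz (Or.inl hz₁),
      h₂.2.2 z fun hz₂ => hz (Or.inr hz₂), add_zero]

end Surrounds

/-! ### Boundaries of unions of grid squares -/

section Grid

/-- The outer normals `1, I, -1, -I` of a square, in positive order. -/
def normal (d : Fin 4) : GaussianInt := Zsqrtd.sqrtd ^ (d : ℕ)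

/-- The grid of mesh `2 * h` consists of the squares of side `2 * h` centred at the points
`2 * h * q` with `q` a Gaussian integer; `edge h (q, d)` is the positively oriented edge with outer
normal `normal d` of the square with index `q`. -/
def edge (h : ℝ) (p : GaussianInt × Fin 4) (t : ℝ) : ℂ :=
  h * (2 * (p.1 : ℂ) + (normal p.2 : ℂ) * (1 + Complex.I * (2 * t - 1)))

/-- The label of the edge `p` as an edge of the adjacent square, which orients it oppositely. -/
def reverse (p : GaussianInt × Fin 4) : GaussianInt × Fin 4 := (p.1 + normal p.2, p.2 + 2)

theorem toComplex_sqrtd : ((Zsqrtd.sqrtd : GaussianInt) : ℂ) = Complex.I := by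
  simp [GaussianInt.toComplex_def]

theorem normal_add_one (d : Fin 4) : normal (d + 1) = Zsqrtd.sqrtd * normal d := by
  revert d
  unfold normal
  decide

theorem normal_add_two (d : Fin 4) : normal (d + 2) = -normal d := by
  revert d
  unfold normal
  decide

theorem toComplex_normal_ne_zero (d : Fin 4) : (normal d : ℂ) ≠ 0 := by
  rw [normal, map_pow, toComplex_sqrtd]
  exact pow_ne_zero _ Complex.I_ne_zero

variable {h : ℝ}

theorem reverse_reverse (p : GaussianInt × Fin 4) : reverse (reverse p) = p := by
  refine Prod.ext ?_ ?_
  · simp only [reverse, normal_add_two, add_neg_cancel_right]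
  · simp only [reverse, add_assoc]
    exact add_zero _

theorem edge_reverse (p : GaussianInt × Fin 4) (t : ℝ) :
    edge h (reverse p) t = edge h p (1 - t) := by
  simp only [edge, reverse, normal_add_two, map_add, map_neg]
  push_cast
  ring

theorem edge_one (q : GaussianInt) (d : Fin 4) : edge h (q, d) 1 = edge h (q, d + 1) 0 := by
  simp only [edge, normal_add_one, map_mul, toComplex_sqrtd]
  push_cast
  linear_combination (h : ℂ) * normal d * Complex.I_mul_I

theorem contDiff_edge (p : GaussianInt × Fin 4) : ContDiff ℝ 1 (edge h p) := by
  have : ContDiff ℝ 1 (fun t : ℝ => (t : ℂ)) := Complex.ofRealCLM.contDiff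
  unfold edge
  fun_prop

theorem hasDerivAt_edge (p : GaussianInt × Fin 4) (t : ℝ) :
    HasDerivAt (edge h p) (h * (normal p.2 * (Complex.I * 2))) t := by
  have hasDerivAt_ofReal : HasDerivAt (fun t : ℝ => (t : ℂ)) 1 t := Complex.ofRealCLM.hasDerivAt
  refine ((((((hasDerivAt_ofReal.const_mul 2).sub_const 1).const_mul Complex.I).const_add
    1).const_mul (normal p.2 : ℂ)).const_add (2 * (p.1 : ℂ)) |>.const_mul (h : ℂ)).congr_deriv ?_
  rw [mul_one]

/-- The integral along an edge. -/
def edgeIntegral (h : ℝ) (p : GaussianInt × Fin 4) (f : ℂ → E) : E :=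
  ∫ t in (0 : ℝ)..1, derivWithin (edge h p) (Icc 0 1) t • f (edge h p t)

theorem edgeIntegral_eq (p : GaussianInt × Fin 4) (f : ℂ → E) :
    edgeIntegral h p f =
      ∫ t in (0 : ℝ)..1, (h * (normal p.2 * (Complex.I * 2)) : ℂ) • f (edge h p t) := by
  refine intervalIntegral.integral_congr fun t ht => ?_
  rw [uIcc_of_le zero_le_one] at ht
  simp only [(hasDerivAt_edge p t).hasDerivWithinAt.derivWithin (uniqueDiffOn_Icc zero_lt_one t ht)]

theorem edgeIntegral_reverse (p : GaussianInt × Fin 4) (f : ℂ → E) :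
    edgeIntegral h (reverse p) f = -edgeIntegral h p f := by
  have hsubst := intervalIntegral.integral_comp_sub_left (a := 0) (b := 1)
    (fun t => (h * (normal p.2 * (Complex.I * 2)) : ℂ) • f (edge h p t)) 1
  rw [sub_zero, sub_self] at hsubst
  rw [edgeIntegral_eq, edgeIntegral_eq, ← hsubst, ← intervalIntegral.integral_neg]
  simp only [edge_reverse]
  simp only [reverse, normal_add_two, map_neg, neg_mul, mul_neg, neg_smul]

/-- The edges of the squares in `S` whose adjacent square is not in `S`. -/
def boundaryEdges (S : Finset GaussianInt) : Finset (GaussianInt × Fin 4) :=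
  {p ∈ S ×ˢ Finset.univ | (reverse p).1 ∉ S}

/-- The edges of the squares in `S` whose adjacent square is in `S`, too. -/
def innerEdges (S : Finset GaussianInt) : Finset (GaussianInt × Fin 4) :=
  {p ∈ S ×ˢ Finset.univ | ¬ (reverse p).1 ∉ S}

theorem sum_boundaryEdges_add_sum_innerEdges {M : Type*} [AddCommMonoid M]
    (S : Finset GaussianInt) (g : GaussianInt × Fin 4 → M) :
    ∑ p ∈ boundaryEdges S, g p + ∑ p ∈ innerEdges S, g p = ∑ q ∈ S, ∑ d, g (q, d) := by
  rw [boundaryEdges, innerEdges, Finset.sum_filter_add_sum_filter_not, Finset.sum_product]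

theorem sum_innerEdges_reverse {M : Type*} [AddCommMonoid M]
    (S : Finset GaussianInt) (g : GaussianInt × Fin 4 → M) :
    ∑ p ∈ innerEdges S, g (reverse p) = ∑ p ∈ innerEdges S, g p := by
  have reverse_mem (p) (hp : p ∈ innerEdges S) : reverse p ∈ innerEdges S := by
    simp only [innerEdges, Finset.mem_filter, Finset.mem_product, Finset.mem_univ, and_true,
      not_not, reverse_reverse] at hp ⊢
    exact hp.symm
  exact Finset.sum_nbij' reverse reverse reverse_mem reverse_mem (fun p _ => reverse_reverse p)
    (fun p _ => reverse_reverse p) fun _ _ => rfl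

theorem sum_boundaryEdges_endpoints (S : Finset GaussianInt) :
    ∑ p ∈ boundaryEdges S, ({edge h p 0} : Multiset ℂ) = ∑ p ∈ boundaryEdges S, {edge h p 1} := by
  have inner_endpoints := sum_innerEdges_reverse S fun p => ({edge h p 0} : Multiset ℂ)
  simp only [edge_reverse, sub_zero] at inner_endpoints
  refine add_right_cancel (b := ∑ p ∈ innerEdges S, ({edge h p 1} : Multiset ℂ)) ?_
  rw [sum_boundaryEdges_add_sum_innerEdges, inner_endpoints, sum_boundaryEdges_add_sum_innerEdges]
  simp only [edge_one]
  exact Finset.sum_congr rfl fun q _ => (Equiv.sum_comp (Equiv.addRight (1 : Fin 4))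
    fun d => ({edge h (q, d) 0} : Multiset ℂ)).symm

/-- The oriented boundary of the union of the squares with index in `S` in the grid of
mesh `2 * h`. -/
def gridCycle (h : ℝ) (S : Finset GaussianInt) : PlaneCycle :=
  ofFintype (fun p : boundaryEdges S => edge h p) (fun p => (contDiff_edge _).contDiffOn) (by
    have map_univ_eq_sum (g : GaussianInt × Fin 4 → ℂ) :
        (Finset.univ.val.map fun p : boundaryEdges S => g p) = ∑ p ∈ boundaryEdges S, {g p} := by
      rw [← Finset.sum_coe_sort, ← Multiset.sum_map_singleton (Multiset.map _ _), Multiset.map_map]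
      rfl
    rw [map_univ_eq_sum (edge h · 0), map_univ_eq_sum (edge h · 1), sum_boundaryEdges_endpoints])

theorem mem_trace_gridCycle {S : Finset GaussianInt} {z : ℂ} :
    z ∈ (gridCycle h S).trace ↔ ∃ p ∈ boundaryEdges S, ∃ t ∈ Icc (0 : ℝ) 1, edge h p t = z := by
  simp only [gridCycle, trace_ofFintype, mem_iUnion, mem_image, Subtype.exists, exists_prop]

theorem integral_gridCycle (S : Finset GaussianInt) (f : ℂ → E) :
    (gridCycle h S).integral f = ∑ q ∈ S, ∑ d, edgeIntegral h (q, d) f := by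
  have inner_cancel : ∑ p ∈ innerEdges S, edgeIntegral h p f = 0 := by
    have : IsAddTorsionFree E := .of_isTorsionFree ℂ E
    refine self_eq_neg.1 ?_
    rw [← Finset.sum_neg_distrib, ← sum_innerEdges_reverse]
    simp only [edgeIntegral_reverse]
  rw [← sum_boundaryEdges_add_sum_innerEdges S fun p => edgeIntegral h p f, inner_cancel, add_zero,
    gridCycle, integral_ofFintype]
  exact Finset.sum_coe_sort (boundaryEdges S) (edgeIntegral h · f)

theorem integral_gridCycle_eq_sum (S : Finset GaussianInt) (f : ℂ → E) :
    (gridCycle h S).integral f = ∑ q ∈ S, (gridCycle h {q}).integral f := by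
  simp only [integral_gridCycle, Finset.sum_singleton]

theorem index_gridCycle_eq_sum (S : Finset GaussianInt) (z : ℂ) :
    (gridCycle h S).index z = ∑ q ∈ S, (gridCycle h {q}).index z := by
  simp only [index, integral_gridCycle_eq_sum S, Finset.mul_sum]

end Grid

section Square

/-- The closed square with index `q` in the grid of mesh `2 * h`. -/
def square (h : ℝ) (q : GaussianInt) : Set ℂ :=
  Icc (h * (2 * q.re - 1)) (h * (2 * q.re + 1)) ×ℂ Icc (h * (2 * q.im - 1)) (h * (2 * q.im + 1))

variable {h : ℝ} {q q' : GaussianInt} {S : Finset GaussianInt} {z : ℂ} {K U : Set ℂ}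

theorem interior_square : interior (square h q) =
    Ioo (h * (2 * q.re - 1)) (h * (2 * q.re + 1)) ×ℂ
      Ioo (h * (2 * q.im - 1)) (h * (2 * q.im + 1)) := by
  rw [square, Complex.interior_reProdIm, interior_Icc, interior_Icc]

theorem closure_interior_square (hh : 0 < h) : closure (interior (square h q)) = square h q := by
  have hne (m : ℤ) : h * (2 * m - 1) ≠ h * (2 * m + 1) := by
    intro heq
    linarith
  rw [interior_square, Complex.closure_reProdIm, closure_Ioo (hne _), closure_Ioo (hne _), square]

theorem isPreconnected_interior_square : IsPreconnected (interior (square h q)) := by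
  rw [interior_square]
  exact (((convex_Ioo _ _).linear_preimage Complex.reLm).inter
    ((convex_Ioo _ _).linear_preimage Complex.imLm)).isPreconnected

theorem center_mem_interior_square (hh : 0 < h) : h * (2 * (q : ℂ)) ∈ interior (square h q) := by
  rw [interior_square, Complex.mem_reProdIm]
  simp [hh]

theorem square_subset_ball (hh : 0 < h) : square h q ⊆ Metric.ball (h * (2 * (q : ℂ))) (3 * h) := by
  intro z hz
  simp only [square, Complex.mem_reProdIm, mem_Icc, GaussianInt.intCast_re,
    GaussianInt.intCast_im] at hz
  have hre : |(z - h * (2 * (q : ℂ))).re| ≤ h := by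
    rw [abs_le]
    constructor <;> simp <;> linarith
  have him : |(z - h * (2 * (q : ℂ))).im| ≤ h := by
    rw [abs_le]
    constructor <;> simp <;> linarith
  rw [Metric.mem_ball, dist_eq_norm]
  linarith [Complex.norm_le_abs_re_add_abs_im (z - h * (2 * (q : ℂ)))]

theorem edge_mem_square (hh : 0 ≤ h) (p : GaussianInt × Fin 4) {t : ℝ} (ht : t ∈ Icc (0 : ℝ) 1) :
    edge h p t ∈ square h p.1 := by
  obtain ⟨q, d⟩ := p
  have h₀ : 0 ≤ h * t := mul_nonneg hh ht.1
  have h₁ : h * t ≤ h := mul_le_of_le_one_right hh ht.2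
  refine Complex.mem_reProdIm.2 ⟨⟨?_, ?_⟩, ?_, ?_⟩ <;> fin_cases d <;>
    simp [edge, normal, toComplex_sqrtd, pow_succ] <;> linarith

theorem exists_mem_square_of_mem_trace (hh : 0 ≤ h) (hz : z ∈ (gridCycle h S).trace) :
    ∃ q ∈ S, z ∈ square h q := by
  obtain ⟨p, hp, t, ht, rfl⟩ := mem_trace_gridCycle.1 hz
  exact ⟨p.1, (Finset.mem_product.1 (Finset.mem_filter.1 hp).1).1, edge_mem_square hh p ht⟩

theorem trace_gridCycle_singleton_subset (hh : 0 ≤ h) : (gridCycle h {q}).trace ⊆ square h q :=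
  fun z hz => by simpa using exists_mem_square_of_mem_trace hh hz

theorem disjoint_trace_gridCycle (hh : 0 ≤ h)
    (hS : ∀ q, (square h q ∩ K).Nonempty → q ∈ S) : Disjoint (gridCycle h S).trace K := by
  refine disjoint_left.2 fun z hz hzK => ?_
  obtain ⟨p, hp, t, ht, rfl⟩ := mem_trace_gridCycle.1 hz
  refine (Finset.mem_filter.1 hp).2 (hS _ ⟨_, ?_, hzK⟩)
  rw [← sub_sub_cancel 1 t, ← edge_reverse]
  exact edge_mem_square hh _ ⟨sub_nonneg.2 ht.2, sub_le_self 1 ht.1⟩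

theorem integral_gridCycle_singleton_eq_zero [CompleteSpace E] (hh : 0 < h) {f : ℂ → E}
    (hf : DifferentiableOn ℂ f (Metric.ball (h * (2 * (q : ℂ))) (3 * h))) :
    (gridCycle h {q}).integral f = 0 := by
  have hsub := (trace_gridCycle_singleton_subset hh.le).trans (square_subset_ball (q := q) hh)
  obtain ⟨g, hg⟩ := hf.isExactOn_ball
  exact integral_eq_zero_of_hasDerivAt (fun z hz => hg z (hsub hz)) (hf.continuousOn.mono hsub)

theorem disjoint_interior_square_trace :
    Disjoint (interior (square h q)) (gridCycle h {q}).trace := by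
  refine disjoint_right.2 fun z hz => ?_
  obtain ⟨⟨q, d⟩, hp, t, -, rfl⟩ := mem_trace_gridCycle.1 hz
  simp only [boundaryEdges, Finset.mem_filter, Finset.mem_product, Finset.mem_singleton] at hp
  obtain rfl := hp.1.1
  rw [interior_square]
  rintro ⟨⟨hre, hre'⟩, him, him'⟩
  fin_cases d <;> simp [edge, normal, toComplex_sqrtd, pow_succ] at hre hre' him him' <;> linarith

theorem log_one_add_I_sub_log_one_sub_I :
    Complex.log (1 + Complex.I) - Complex.log (1 - Complex.I) = Real.pi / 2 * Complex.I := by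
  have hmul : 1 + Complex.I = Complex.I * (1 - Complex.I) := by
    rw [mul_sub, Complex.I_mul_I]
    ring
  have harg : Complex.arg (1 - Complex.I) < 0 := Complex.arg_neg_iff.2 (by simp)
  rw [hmul, Complex.log_mul Complex.I_ne_zero, Complex.log_I, add_sub_cancel_right]
  · exact fun h0 => by simpa using congrArg Complex.re h0
  · rw [Complex.arg_I]
    constructor <;> linarith [Complex.neg_pi_lt_arg (1 - Complex.I), Real.pi_pos]

theorem edgeIntegral_sub_center_inv (hh : h ≠ 0) (p : GaussianInt × Fin 4) :
    edgeIntegral h p (fun z => (z - h * (2 * (p.1 : ℂ)))⁻¹) = Real.pi / 2 * Complex.I := by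
  have hne (t : ℝ) : (1 + Complex.I * (2 * t - 1) : ℂ) ∈ Complex.slitPlane :=
    Complex.mem_slitPlane_iff.2 (Or.inl (by simp))
  have hderiv (t : ℝ) : HasDerivAt (fun t : ℝ => Complex.log (1 + Complex.I * (2 * t - 1)))
      (Complex.I * 2 / (1 + Complex.I * (2 * t - 1))) t := by
    have hasDerivAt_ofReal : HasDerivAt (fun t : ℝ => (t : ℂ)) 1 t := Complex.ofRealCLM.hasDerivAt
    have := (((hasDerivAt_ofReal.const_mul 2).sub_const 1).const_mul Complex.I).const_add 1
    exact (this.clog_real (hne t)).congr_deriv (by rw [mul_one])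
  have hcont : Continuous fun t : ℝ => Complex.I * 2 / (1 + Complex.I * (2 * t - 1)) :=
    continuous_const.div (by fun_prop) fun t => Complex.slitPlane_ne_zero (hne t)
  have hintegrand (t : ℝ) : (h * (normal p.2 * (Complex.I * 2)) : ℂ) •
      (edge h p t - h * (2 * (p.1 : ℂ)))⁻¹ = Complex.I * 2 / (1 + Complex.I * (2 * t - 1)) := by
    have := toComplex_normal_ne_zero p.2
    have := Complex.slitPlane_ne_zero (hne t)
    have := Complex.ofReal_ne_zero.2 hh
    rw [edge, mul_add, add_sub_cancel_left, smul_eq_mul]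
    field_simp
  simp only [edgeIntegral_eq, hintegrand]
  rw [intervalIntegral.integral_eq_sub_of_hasDerivAt (fun t _ => hderiv t)
    (hcont.intervalIntegrable _ _), ← log_one_add_I_sub_log_one_sub_I]
  congr 2 <;> push_cast <;> ring

theorem index_gridCycle_singleton_of_mem_interior (hh : 0 < h) (hz : z ∈ interior (square h q)) :
    (gridCycle h {q}).index z = 1 := by
  rw [index_eq_of_isPreconnected isPreconnected_interior_square disjoint_interior_square_trace
    hz (center_mem_interior_square hh), index, integral_gridCycle, Finset.sum_singleton]
  simp only [edgeIntegral_sub_center_inv hh.ne', Finset.sum_const, Finset.card_univ,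
    Fintype.card_fin]
  rw [inv_mul_eq_one₀ Complex.two_pi_I_ne_zero, nsmul_eq_mul]
  push_cast
  ring

theorem index_gridCycle_singleton_of_notMem (hh : 0 ≤ h) (hz : z ∉ square h q) :
    (gridCycle h {q}).index z = 0 := by
  have hmem (w) (hw : w ∈ (gridCycle h {q}).trace) :=
    Complex.mem_reProdIm.1 (trace_gridCycle_singleton_subset hh hw)
  simp only [mem_Icc] at hmem
  simp only [square, Complex.mem_reProdIm, mem_Icc, not_and_or, not_le] at hz
  rcases hz with (left | right) | (below | above)
  · exact index_eq_zero_of_re_pos (k := 1) fun w hw => by simp; linarith [hmem w hw]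
  · exact index_eq_zero_of_re_pos (k := -1) fun w hw => by simp; linarith [hmem w hw]
  · exact index_eq_zero_of_re_pos (k := -Complex.I) fun w hw => by simp; linarith [hmem w hw]
  · exact index_eq_zero_of_re_pos (k := Complex.I) fun w hw => by simp; linarith [hmem w hw]

theorem index_gridCycle_eq_zero (hh : 0 ≤ h) (hz : ∀ q ∈ S, z ∉ square h q) :
    (gridCycle h S).index z = 0 := by
  rw [index_gridCycle_eq_sum]
  exact Finset.sum_eq_zero fun q hq => index_gridCycle_singleton_of_notMem hh (hz q hq)

theorem eq_of_mem_Ioo_of_mem_Icc (hh : 0 < h) {x : ℝ} {m n : ℤ}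
    (hm : x ∈ Ioo (h * (2 * m - 1)) (h * (2 * m + 1)))
    (hn : x ∈ Icc (h * (2 * n - 1)) (h * (2 * n + 1))) : n = m := by
  have hlt : (2 * m - 1 : ℝ) < 2 * n + 1 := lt_of_mul_lt_mul_left (hm.1.trans_le hn.2) hh.le
  have hgt : (2 * n - 1 : ℝ) < 2 * m + 1 := lt_of_mul_lt_mul_left (hn.1.trans_lt hm.2) hh.le
  norm_cast at hlt hgt
  omega

theorem eq_of_mem_interior_square_of_mem_square (hh : 0 < h) (hz : z ∈ interior (square h q))
    (hz' : z ∈ square h q') : q' = q := by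
  rw [interior_square] at hz
  exact Zsqrtd.ext (eq_of_mem_Ioo_of_mem_Icc hh hz.1 hz'.1)
    (eq_of_mem_Ioo_of_mem_Icc hh hz.2 hz'.2)

theorem index_gridCycle_eq_one (hh : 0 < h) (hq : q ∈ S) (hz : z ∈ square h q)
    (hz_trace : z ∉ (gridCycle h S).trace) : (gridCycle h S).index z = 1 := by
  rw [← closure_interior_square hh] at hz
  obtain ⟨w, hw, hw_index⟩ := ((mem_closure_iff_frequently.1 hz).and_eventually
    (index_eventuallyEq hz_trace)).exists
  rw [← hw_index, index_gridCycle_eq_sum, Finset.sum_eq_single_of_mem q hq fun q' _ hne =>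
    index_gridCycle_singleton_of_notMem hh.le fun hw' =>
      hne (eq_of_mem_interior_square_of_mem_square hh hw hw')]
  exact index_gridCycle_singleton_of_mem_interior hh hw

theorem exists_mem_square (hh : 0 < h) (z : ℂ) : ∃ q, z ∈ square h q := by
  have exists_mem_Icc (x : ℝ) : ∃ m : ℤ, x ∈ Icc (h * (2 * m - 1)) (h * (2 * m + 1)) := by
    obtain ⟨m, ⟨hm₁, hm₂⟩, -⟩ := existsUnique_sub_zsmul_mem_Ico (mul_pos two_pos hh) x (-h)
    rw [zsmul_eq_mul] at hm₁ hm₂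
    exact ⟨m, by linarith, by linarith⟩
  obtain ⟨m, hm⟩ := exists_mem_Icc z.re
  obtain ⟨n, hn⟩ := exists_mem_Icc z.im
  exact ⟨⟨m, n⟩, hm, hn⟩

theorem finite_setOf_square_inter_nonempty (hh : 0 < h) (hK : Bornology.IsBounded K) :
    {q | (square h q ∩ K).Nonempty}.Finite := by
  obtain ⟨R, hR⟩ := hK.exists_norm_le
  have bounded_index {x : ℝ} {m : ℤ} (hx : |x| ≤ R)
      (hm : x ∈ Icc (h * (2 * m - 1)) (h * (2 * m + 1))) :
      m ∈ ((↑) : ℤ → ℝ) ⁻¹' Icc (-((R + h) / (2 * h))) ((R + h) / (2 * h)) := by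
    rw [mem_preimage, mem_Icc, ← neg_div, div_le_iff₀ (by positivity), le_div_iff₀ (by positivity)]
    constructor <;> linarith [abs_le.1 hx, hm.1, hm.2]
  have finite_index : (((↑) : ℤ → ℝ) ⁻¹'
      Icc (-((R + h) / (2 * h))) ((R + h) / (2 * h))).Finite := by
    rw [Int.preimage_Icc]
    exact finite_Icc _ _
  refine ((finite_index.prod finite_index).preimage (f := fun q : GaussianInt => (q.re, q.im))
    fun p _ q _ hpq => Zsqrtd.ext (Prod.ext_iff.1 hpq).1 (Prod.ext_iff.1 hpq).2).subset ?_
  rintro q ⟨z, hzq, hzK⟩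
  exact ⟨bounded_index ((Complex.abs_re_le_norm z).trans (hR z hzK)) hzq.1,
    bounded_index ((Complex.abs_im_le_norm z).trans (hR z hzK)) hzq.2⟩

theorem exists_gridCycle_surrounds (hK : IsCompact K) (hU : IsOpen U) (hKU : K ⊆ U) :
    ∃ (h : ℝ) (S : Finset GaussianInt), 0 < h ∧
      (∀ q ∈ S, Metric.ball (h * (2 * (q : ℂ))) (3 * h) ⊆ U) ∧ (gridCycle h S).Surrounds K U := by
  obtain ⟨δ, hδ, hthick⟩ := hK.exists_thickening_subset_open hU hKU
  obtain ⟨h, hh, rfl⟩ : ∃ h : ℝ, 0 < h ∧ 6 * h = δ := ⟨δ / 6, by positivity, by ring⟩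
  have hfin := finite_setOf_square_inter_nonempty hh hK.isBounded
  have hball (q) (hq : q ∈ hfin.toFinset) : Metric.ball (h * (2 * (q : ℂ))) (3 * h) ⊆ U := by
    obtain ⟨k, hkq, hkK⟩ := hfin.mem_toFinset.1 hq
    refine fun w hw => hthick (Metric.mem_thickening_iff.2 ⟨k, hkK, ?_⟩)
    linarith [dist_triangle_right w k (h * (2 * (q : ℂ))), Metric.mem_ball.1 hw,
      Metric.mem_ball.1 (square_subset_ball hh hkq)]
  have square_subset (q) (hq : q ∈ hfin.toFinset) : square h q ⊆ U :=
    (square_subset_ball hh).trans (hball q hq)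
  have hdisj : Disjoint (gridCycle h hfin.toFinset).trace K :=
    disjoint_trace_gridCycle hh.le fun q hq => hfin.mem_toFinset.2 hq
  refine ⟨h, hfin.toFinset, hh, hball, fun z hz => ⟨?_, disjoint_left.1 hdisj hz⟩,
    fun z hz => ?_, fun z hz => ?_⟩
  · obtain ⟨q, hq, hzq⟩ := exists_mem_square_of_mem_trace hh.le hz
    exact square_subset q hq hzq
  · obtain ⟨q, hzq⟩ := exists_mem_square hh z
    exact index_gridCycle_eq_one hh (hfin.mem_toFinset.2 ⟨z, hzq, hz⟩) hzq
      (disjoint_right.1 hdisj hz)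
  · exact index_gridCycle_eq_zero hh.le fun q hq hzq => hz (square_subset q hq hzq)

theorem exists_surrounds (hK : IsCompact K) (hU : IsOpen U) (hKU : K ⊆ U) :
    ∃ Γ : PlaneCycle, Γ.Surrounds K U := by
  obtain ⟨h, S, -, -, hS⟩ := exists_gridCycle_surrounds hK hU hKU
  exact ⟨_, hS⟩

end Square

/-! ### Cauchy's theorem -/

section Cauchy

variable {Γ Γ' Γ₁ Γ₂ : PlaneCycle} {K U : Set ℂ} {f : ℂ → E}

theorem continuousOn_dslope_of_disjoint {g : ℂ → E} {s t : Set ℂ} (hst : Disjoint s t)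
    (hs : ContinuousOn g s) (ht : ContinuousOn g t) :
    ContinuousOn (fun p : ℂ × ℂ => dslope g p.2 p.1) (s ×ˢ t) := by
  have hslope : EqOn (fun p : ℂ × ℂ => dslope g p.2 p.1) (fun p => (p.1 - p.2)⁻¹ • (g p.1 - g p.2))
      (s ×ˢ t) := fun p hp => by
    simp only [dslope_of_ne _ (hst.ne_of_mem hp.1 hp.2), slope_def_module]
  refine ContinuousOn.congr (ContinuousOn.fun_smul (ContinuousOn.inv₀ (by fun_prop) fun p hp =>
    sub_ne_zero.2 (hst.ne_of_mem hp.1 hp.2)) (ContinuousOn.fun_sub ?_ ?_)) hslope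
  · exact hs.comp continuousOn_fst fun p hp => hp.1
  · exact ht.comp continuousOn_snd fun p hp => hp.2

variable [CompleteSpace E]

theorem cauchy_formula_of_integral_eq_zero (hU : IsOpen U) (hΓ : Γ.trace ⊆ U)
    (hzero : ∀ g : ℂ → E, DifferentiableOn ℂ g U → Γ.integral g = 0)
    (hf : DifferentiableOn ℂ f U) {z : ℂ} (hz : z ∈ U) (hzΓ : z ∉ Γ.trace) :
    Γ.integral (fun w => (w - z)⁻¹ • f w) = (2 * Real.pi * Complex.I * Γ.index z) • f z := by
  have hc := continuousOn_sub_inv hzΓ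
  have hslope : EqOn (dslope f z) (fun w => (w - z)⁻¹ • f w - (w - z)⁻¹ • f z) Γ.trace :=
    fun w hw => by
      rw [dslope_of_ne _ (ne_of_mem_of_not_mem hw hzΓ), slope_def_module, smul_sub]
  rw [← integral_sub_inv, ← integral_smul_const, ← sub_eq_zero,
    ← integral_sub (hc.fun_smul (hf.continuousOn.mono hΓ)) (hc.fun_smul continuousOn_const),
    ← integral_congr hslope]
  exact hzero _ ((Complex.differentiableOn_dslope (hU.mem_nhds hz)).2 hf)

theorem integral_eq_neg_integral_index_smul (hU : IsOpen U) (hΓ : Γ.Surrounds Γ'.trace U)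
    (hΓ' : Γ'.trace ⊆ U)
    (hzero : ∀ g : ℂ → E, DifferentiableOn ℂ g U → Γ.integral g = 0)
    (hf : DifferentiableOn ℂ f U) :
    Γ'.integral f = -Γ.integral fun w => Γ'.index w • f w := by
  have hΓU : Γ.trace ⊆ U := hΓ.1.trans sdiff_subset
  have hcauchy : EqOn (fun z => (2 * Real.pi * Complex.I : ℂ) • f z)
      (fun z => Γ.integral fun w => (w - z)⁻¹ • f w) Γ'.trace := fun z hz => by
    simp only [cauchy_formula_of_integral_eq_zero hU hΓU hzero hf (hΓ' hz) fun h => (hΓ.1 h).2 hz,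
      hΓ.2.1 z hz, mul_one]
  have hcont : ContinuousOn (fun p : ℂ × ℂ => (p.2 - p.1)⁻¹ • f p.2) (Γ'.trace ×ˢ Γ.trace) := by
    refine ContinuousOn.smul (ContinuousOn.inv₀ (by fun_prop) ?_)
      ((hf.continuousOn.mono hΓU).comp continuousOn_snd fun p hp => hp.2)
    exact fun p hp h => (hΓ.1 hp.2).2 (sub_eq_zero.1 h ▸ hp.1)
  have hinner (w : ℂ) : Γ'.integral (fun z => (w - z)⁻¹ • f w) =
      -(2 * Real.pi * Complex.I : ℂ) • Γ'.index w • f w := by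
    rw [← neg_one_smul ℂ, smul_assoc, smul_smul (2 * Real.pi * Complex.I : ℂ),
      ← integral_sub_inv, ← integral_smul_const, ← integral_const_smul]
    simp only [neg_one_smul, ← neg_smul, ← inv_neg, neg_sub]
  apply smul_right_injective E Complex.two_pi_I_ne_zero
  simp only
  rw [← integral_const_smul, integral_congr hcauchy, integral_integral_swap hcont]
  simp only [hinner]
  rw [integral_const_smul, neg_smul, smul_neg]

theorem isCompact_trace_union_index_ne (Γ₁ Γ₂ : PlaneCycle) :
    IsCompact (Γ₁.trace ∪ Γ₂.trace ∪ {z | Γ₁.index z ≠ Γ₂.index z}) := by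
  have htr : IsCompact (Γ₁.trace ∪ Γ₂.trace) := Γ₁.isCompact_trace.union Γ₂.isCompact_trace
  refine Metric.isCompact_of_isClosed_isBounded (isOpen_compl_iff.1 ?_) ?_
  · refine isOpen_iff_mem_nhds.2 fun z hz => ?_
    simp only [mem_compl_iff, mem_union, not_or, mem_ofPred_eq, not_not] at hz
    filter_upwards [index_eventuallyEq hz.1.1, index_eventuallyEq hz.1.2,
      htr.isClosed.isOpen_compl.mem_nhds (not_or.2 hz.1)] with w h₁ h₂ hw
    exact not_or.2 ⟨hw, not_not.2 (by rw [h₁, h₂, hz.2])⟩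
  · obtain ⟨R, hR⟩ := htr.isBounded.exists_norm_le
    refine isBounded_iff_forall_norm_le.2 ⟨R, fun z hz => ?_⟩
    contrapose! hz
    refine not_or.2 ⟨fun h => hz.not_ge (hR z h), not_not.2 ?_⟩
    rw [index_eq_zero_of_norm_lt fun w hw => (hR w (Or.inl hw)).trans_lt hz,
      index_eq_zero_of_norm_lt fun w hw => (hR w (Or.inr hw)).trans_lt hz]

theorem integral_eq_of_index_eq (hU : IsOpen U) (h₁ : Γ₁.trace ⊆ U) (h₂ : Γ₂.trace ⊆ U)
    (hind : ∀ z ∉ U, Γ₁.index z = Γ₂.index z) (hf : DifferentiableOn ℂ f U) :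
    Γ₁.integral f = Γ₂.integral f := by
  obtain ⟨h, S, hh, hball, hΓ⟩ := exists_gridCycle_surrounds
    (isCompact_trace_union_index_ne Γ₁ Γ₂) hU
    (union_subset (union_subset h₁ h₂) fun z hz => not_imp_comm.1 (hind z) hz)
  have hzero (g : ℂ → E) (hg : DifferentiableOn ℂ g U) : (gridCycle h S).integral g = 0 := by
    rw [integral_gridCycle_eq_sum]
    exact Finset.sum_eq_zero fun q hq =>
      integral_gridCycle_singleton_eq_zero hh (hg.mono (hball q hq))
  have hindex : ∀ w ∈ (gridCycle h S).trace, Γ₁.index w = Γ₂.index w := fun w hw =>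
    not_not.1 fun hne => (hΓ.1 hw).2 (Or.inr hne)
  rw [integral_eq_neg_integral_index_smul hU
      (hΓ.mono (subset_union_left.trans subset_union_left) Subset.rfl) h₁ hzero hf,
    integral_eq_neg_integral_index_smul hU
      (hΓ.mono (subset_union_right.trans subset_union_left) Subset.rfl) h₂ hzero hf,
    integral_congr fun w hw => by rw [hindex w hw]]

theorem integral_eq_zero_of_index_eq_zero (hU : IsOpen U) (hΓ : Γ.trace ⊆ U)
    (hind : ∀ z ∉ U, Γ.index z = 0) (hf : DifferentiableOn ℂ f U) : Γ.integral f = 0 := by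
  have h : (Γ.append Γ).integral f = Γ.integral f :=
    integral_eq_of_index_eq hU (by rwa [trace_append, union_self]) hΓ
      (fun z hz => by rw [index_append, hind z hz, add_zero]) hf
  rwa [integral_append, add_eq_left] at h

theorem Surrounds.integral_eq (h₁ : Γ₁.Surrounds K U) (h₂ : Γ₂.Surrounds K U) (hK : IsClosed K)
    (hU : IsOpen U) (hf : DifferentiableOn ℂ f (U \ K)) : Γ₁.integral f = Γ₂.integral f := by
  refine integral_eq_of_index_eq (hU.sdiff hK) h₁.1 h₂.1 (fun z hz => ?_) hf
  by_cases hzK : z ∈ K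
  · rw [h₁.2.1 z hzK, h₂.2.1 z hzK]
  · have hzU : z ∉ U := fun hzU => hz ⟨hzU, hzK⟩
    rw [h₁.2.2 z hzU, h₂.2.2 z hzU]

theorem Surrounds.integral_eq_zero (h : Γ.Surrounds K U) (hU : IsOpen U)
    (hf : DifferentiableOn ℂ f U) : Γ.integral f = 0 :=
  integral_eq_zero_of_index_eq_zero hU (h.1.trans sdiff_subset) h.2.2 hf

theorem integral_integral_dslope_eq_zero {f g : ℂ → ℂ} {F : ℂ → E} (hΓ : Γ.Surrounds K U)
    (hU : IsOpen U) (hΓ' : Γ'.trace ⊆ U) (hdisj : Disjoint Γ.trace Γ'.trace)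
    (hf : DifferentiableOn ℂ f U) (hg : DifferentiableOn ℂ g U) (hF : ContinuousOn F Γ'.trace) :
    Γ.integral (fun z => f z • Γ'.integral fun w => dslope g z w • F w) = 0 := by
  have hΓU : Γ.trace ⊆ U := hΓ.1.trans sdiff_subset
  have hinner : ∀ w ∈ Γ'.trace, Γ.integral (fun z => f z * dslope g w z) = 0 := fun w hw =>
    hΓ.integral_eq_zero hU
      (hf.mul ((Complex.differentiableOn_dslope (hU.mem_nhds (hΓ' hw))).2 hg))
  have hcont : ContinuousOn (fun p : ℂ × ℂ => (f p.1 * dslope g p.2 p.1) • F p.2)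
      (Γ.trace ×ˢ Γ'.trace) :=
    ((hf.continuousOn.comp continuousOn_fst fun p hp => hΓU hp.1).mul
      (continuousOn_dslope_of_disjoint hdisj (hg.continuousOn.mono hΓU)
        (hg.continuousOn.mono hΓ'))).smul (hF.comp continuousOn_snd fun p hp => hp.2)
  have hsymm : EqOn (fun z => f z • Γ'.integral fun w => dslope g z w • F w)
      (fun z => Γ'.integral fun w => (f z * dslope g w z) • F w) Γ.trace := fun z hz => by
    simp only [← integral_const_smul]
    refine integral_congr fun w hw => ?_
    have hzw : z ≠ w := hdisj.ne_of_mem hz hw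
    simp only [dslope_of_ne _ hzw, dslope_of_ne _ hzw.symm, slope_comm g z w, mul_smul]
  rw [integral_congr hsymm, integral_integral_swap hcont,
    integral_congr (g := fun w => (0 : ℂ) • F w) fun w hw => by
      rw [integral_smul_const (fun z => f z * dslope g w z) (F w), hinner w hw],
    integral_const_smul, zero_smul]

theorem integral_inv_sq_smul_comp_inv_eq_zero {R : ℝ} (hR : 0 < R) (hΓ : ∀ z ∈ Γ.trace, R < ‖z‖)
    {f : ℂ → E} (hf : DifferentiableOn ℂ f (Metric.ball 0 R⁻¹)) :
    Γ.integral (fun z => (z ^ 2)⁻¹ • f z⁻¹) = 0 := by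
  have hne : ∀ z ∈ Γ.trace, z ≠ 0 := fun z hz => norm_pos_iff.1 (hR.trans (hΓ z hz))
  have hmaps : MapsTo (·⁻¹) Γ.trace (Metric.ball (0 : ℂ) R⁻¹) := fun z hz => by
    rw [mem_ball_zero_iff, norm_inv]
    exact inv_strictAnti₀ hR (hΓ z hz)
  obtain ⟨g, hg⟩ := hf.isExactOn_ball
  refine integral_eq_zero_of_hasDerivAt (g := fun z => -g z⁻¹) (fun z hz => ?_) ?_
  · have h := ((hg _ (hmaps hz)).scomp z (hasDerivAt_inv (hne z hz))).neg
    rwa [neg_smul, neg_neg] at h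
  · have hinv : ContinuousOn (·⁻¹) Γ.trace := continuousOn_inv₀.mono hne
    exact ((continuousOn_pow 2).inv₀ fun z hz => pow_ne_zero 2 (hne z hz)).smul
      (hf.continuousOn.comp hinv hmaps)

end Cauchy

end PlaneCycle

/-! ### The holomorphic functional calculus -/

section FunctionalCalculus

open PlaneCycle

variable {A : Type*} [NormedRing A] [NormedAlgebra ℂ A] {a b c : A}
variable {Γ : PlaneCycle} {U : Set ℂ} {f g : ℂ → ℂ}

theorem sub_mul_resolvent {z : ℂ} (hz : z ∉ spectrum ℂ a) :
    (algebraMap ℂ A z - a) * resolvent a z = 1 :=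
  Ring.mul_inverse_cancel _ (spectrum.notMem_iff.1 hz)

theorem resolvent_mul_sub {z : ℂ} (hz : z ∉ spectrum ℂ a) :
    resolvent a z * (algebraMap ℂ A z - a) = 1 :=
  Ring.inverse_mul_cancel _ (spectrum.notMem_iff.1 hz)

theorem resolvent_eq_inv_smul_resolvent_inv_smul {z : ℂ} (hz : z ≠ 0) :
    resolvent a z = z⁻¹ • resolvent (z⁻¹ • a) (1 : ℂ) :=
  eq_inv_smul_iff₀ hz |>.2 (spectrum.units_smul_resolvent_self (r := Units.mk0 z hz))

theorem smul_resolvent {z : ℂ} (hz : z ∉ spectrum ℂ a) :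
    z • resolvent a z = 1 + a * resolvent a z := by
  rw [Algebra.smul_def, ← sub_mul_resolvent hz, ← add_mul, sub_add_cancel]

/-- The integral `(2πi)⁻¹ ∫_Γ f(z) (z - a)⁻¹ dz`. -/
def resolventIntegral (a : A) (Γ : PlaneCycle) (f : ℂ → ℂ) : A :=
  (2 * Real.pi * Complex.I : ℂ)⁻¹ • Γ.integral fun z => f z • resolvent a z

/-- `b` is the value `f(a)` of the holomorphic functional calculus: `f` is holomorphic on an open
neighbourhood of the spectrum of `a` in which every cycle surrounding the spectrum gives the
value `b`. -/
def HasHolFunCalc (a : A) (f : ℂ → ℂ) (b : A) : Prop :=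
  ∃ U, IsOpen U ∧ spectrum ℂ a ⊆ U ∧ DifferentiableOn ℂ f U ∧
    ∀ Γ : PlaneCycle, Γ.Surrounds (spectrum ℂ a) U → resolventIntegral a Γ f = b

theorem HasHolFunCalc.exists_common (hb : HasHolFunCalc a f b) (hc : HasHolFunCalc a g c) :
    ∃ U, IsOpen U ∧ spectrum ℂ a ⊆ U ∧ DifferentiableOn ℂ f U ∧ DifferentiableOn ℂ g U ∧
      ∀ Γ : PlaneCycle, Γ.Surrounds (spectrum ℂ a) U →
        resolventIntegral a Γ f = b ∧ resolventIntegral a Γ g = c := by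
  obtain ⟨U, hU, haU, hfU, hUb⟩ := hb
  obtain ⟨V, hV, haV, hgV, hVc⟩ := hc
  exact ⟨U ∩ V, hU.inter hV, subset_inter haU haV, hfU.mono inter_subset_left,
    hgV.mono inter_subset_right, fun Γ hΓ => ⟨hUb Γ (hΓ.mono Subset.rfl inter_subset_left),
      hVc Γ (hΓ.mono Subset.rfl inter_subset_right)⟩⟩

theorem HasHolFunCalc.const_smul (hb : HasHolFunCalc a f b) (k : ℂ) :
    HasHolFunCalc a (fun z => k * f z) (k • b) := by
  obtain ⟨U, hU, haU, hf, h⟩ := hb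
  refine ⟨U, hU, haU, hf.const_mul k, fun Γ hΓ => ?_⟩
  simp only [← h Γ hΓ, resolventIntegral, mul_smul, integral_const_smul]
  rw [smul_comm]

variable [CompleteSpace A]

theorem differentiableOn_resolvent (a : A) :
    DifferentiableOn ℂ (resolvent a) (spectrum ℂ a)ᶜ := fun _ hz =>
  (spectrum.hasDerivAt_resolvent_const_left
    (spectrum.notMem_iff.1 hz)).differentiableAt.differentiableWithinAt

theorem differentiableOn_resolvent_smul_one {R : ℝ} (ha : ∀ z ∈ spectrum ℂ a, ‖z‖ ≤ R) :
    DifferentiableOn ℂ (fun u : ℂ => resolvent (u • a) (1 : ℂ)) (Metric.ball 0 R⁻¹) := by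
  intro u hu
  have hunit : IsUnit (algebraMap ℂ A 1 - u • a) := by
    rcases eq_or_ne u 0 with rfl | hu0
    · rw [map_one, zero_smul, sub_zero]
      exact isUnit_one
    · have hres : u⁻¹ ∉ spectrum ℂ a := fun h => by
        rw [mem_ball_zero_iff] at hu
        exact (lt_inv_of_lt_inv₀ (norm_pos_iff.2 hu0) hu).not_ge (norm_inv u ▸ ha _ h)
      have h := (spectrum.notMem_iff.1 hres).smul (Units.mk0 u hu0)
      rwa [Units.smul_mk0, smul_sub, Algebra.algebraMap_eq_smul_one, smul_inv_smul₀ hu0,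
        ← map_one (algebraMap ℂ A)] at h
  exact ((differentiableAt_inverse hunit).comp (f := fun u : ℂ => algebraMap ℂ A 1 - u • a) u
    (by fun_prop)).differentiableWithinAt

theorem continuousOn_smul_resolvent (hΓ : Γ.Surrounds (spectrum ℂ a) U)
    (hf : DifferentiableOn ℂ f U) : ContinuousOn (fun z => f z • resolvent a z) Γ.trace :=
  (hf.continuousOn.mono fun _ hz => (hΓ.1 hz).1).smul
    ((differentiableOn_resolvent a).continuousOn.mono fun _ hz => (hΓ.1 hz).2)

theorem PlaneCycle.Surrounds.resolventIntegral_eq {Γ' : PlaneCycle} {K : Set ℂ}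
    (hΓ : Γ.Surrounds K U) (hΓ' : Γ'.Surrounds K U) (hK : IsClosed K) (hU : IsOpen U)
    (hspec : spectrum ℂ a ∩ U ⊆ K) (hf : DifferentiableOn ℂ f U) :
    resolventIntegral a Γ f = resolventIntegral a Γ' f := by
  rw [resolventIntegral, hΓ.integral_eq hΓ' hK hU, resolventIntegral]
  exact (hf.mono sdiff_subset).smul
    ((differentiableOn_resolvent a).mono fun z hz hzs => hz.2 (hspec ⟨hzs, hz.1⟩))

theorem PlaneCycle.Surrounds.hasHolFunCalc (hΓ : Γ.Surrounds (spectrum ℂ a) U) (hU : IsOpen U)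
    (haU : spectrum ℂ a ⊆ U) (hf : DifferentiableOn ℂ f U) :
    HasHolFunCalc a f (resolventIntegral a Γ f) :=
  ⟨U, hU, haU, hf, fun _ hΓ' =>
    hΓ'.resolventIntegral_eq hΓ (spectrum.isClosed a) hU inter_subset_left hf⟩

theorem exists_hasHolFunCalc (hU : IsOpen U) (haU : spectrum ℂ a ⊆ U)
    (hf : DifferentiableOn ℂ f U) : ∃ b, HasHolFunCalc a f b :=
  let ⟨_, hΓ⟩ := exists_surrounds (spectrum.isCompact a) hU haU
  ⟨_, hΓ.hasHolFunCalc hU haU hf⟩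

namespace HasHolFunCalc

theorem unique (hb : HasHolFunCalc a f b) (hc : HasHolFunCalc a g c)
    (hfg : f =ᶠ[𝓝ˢ (spectrum ℂ a)] g) : b = c := by
  obtain ⟨U, hU, haU, -, hUb⟩ := hb
  obtain ⟨V, hV, haV, -, hVc⟩ := hc
  obtain ⟨W, hW, haW, hWfg⟩ := eventually_nhdsSet_iff_exists.1 hfg
  obtain ⟨Γ, hΓ⟩ := exists_surrounds (spectrum.isCompact a) ((hU.inter hV).inter hW)
    (subset_inter (subset_inter haU haV) haW)
  rw [← hUb Γ (hΓ.mono Subset.rfl (inter_subset_left.trans inter_subset_left)),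
    ← hVc Γ (hΓ.mono Subset.rfl (inter_subset_left.trans inter_subset_right)),
    resolventIntegral, integral_congr fun z hz => by rw [hWfg z (hΓ.1 hz).1.2], resolventIntegral]

theorem add (hb : HasHolFunCalc a f b) (hc : HasHolFunCalc a g c) :
    HasHolFunCalc a (fun z => f z + g z) (b + c) := by
  obtain ⟨U, hU, haU, hf, hg, h⟩ := hb.exists_common hc
  obtain ⟨Γ, hΓ⟩ := exists_surrounds (spectrum.isCompact a) hU haU
  convert hΓ.hasHolFunCalc hU haU (hf.fun_add hg)
  simp only [resolventIntegral, add_smul]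
  rw [integral_add (continuousOn_smul_resolvent hΓ hf) (continuousOn_smul_resolvent hΓ hg),
    smul_add, ← (h Γ hΓ).1, ← (h Γ hΓ).2, resolventIntegral, resolventIntegral]

theorem sub (hb : HasHolFunCalc a f b) (hc : HasHolFunCalc a g c) :
    HasHolFunCalc a (fun z => f z - g z) (b - c) := by
  simpa only [neg_one_mul, neg_one_smul, ← sub_eq_add_neg] using hb.add (hc.const_smul (-1))

theorem one (a : A) : HasHolFunCalc a (fun _ => 1) 1 := by
  obtain ⟨R, hR, haR⟩ := (spectrum.isCompact (𝕜 := ℂ) a).isBounded.exists_pos_norm_le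
  obtain ⟨Γ, hΓ⟩ := exists_surrounds (isCompact_closedBall (0 : ℂ) R) isOpen_univ (subset_univ _)
  have hΓa : Γ.Surrounds (spectrum ℂ a) univ :=
    hΓ.mono (fun z hz => mem_closedBall_zero_iff.2 (haR z hz)) Subset.rfl
  have hRΓ : ∀ z ∈ Γ.trace, R < ‖z‖ := fun z hz =>
    not_le.1 fun h => (hΓ.1 hz).2 (mem_closedBall_zero_iff.2 h)
  have h0Γ : (0 : ℂ) ∉ Γ.trace := fun h => (hΓ.1 h).2 (Metric.mem_closedBall_self hR.le)
  convert hΓa.hasHolFunCalc isOpen_univ (subset_univ _) (differentiableOn_const 1)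
  have hF : DifferentiableOn ℂ (fun u : ℂ => a * resolvent (u • a) (1 : ℂ))
      (Metric.ball 0 R⁻¹) := (differentiableOn_resolvent_smul_one haR).const_mul a
  have hexpand : EqOn (fun z => (z ^ 2)⁻¹ • (a * resolvent (z⁻¹ • a) (1 : ℂ)))
      (fun z => (1 : ℂ) • resolvent a z - (z - 0)⁻¹ • (1 : A)) Γ.trace := fun z hz => by
    have hz0 : z ≠ 0 := ne_of_mem_of_not_mem hz h0Γ
    simp only
    rw [one_smul, sub_zero, (eq_inv_smul_iff₀ hz0).2 (smul_resolvent (hΓa.1 hz).2), smul_add,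
      add_sub_cancel_left, resolvent_eq_inv_smul_resolvent_inv_smul hz0, mul_smul_comm, smul_smul,
      sq, mul_inv]
  have hzero := integral_inv_sq_smul_comp_inv_eq_zero hR hRΓ hF
  rw [integral_congr hexpand, integral_sub
    (continuousOn_smul_resolvent hΓa (differentiableOn_const 1))
    ((continuousOn_sub_inv h0Γ).fun_smul continuousOn_const), PlaneCycle.integral_smul_const,
    integral_sub_inv, hΓ.2.1 0 (Metric.mem_closedBall_self hR.le), mul_one, sub_eq_zero] at hzero
  rw [resolventIntegral, hzero, inv_smul_smul₀ Complex.two_pi_I_ne_zero]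

theorem const (a : A) (k : ℂ) : HasHolFunCalc a (fun _ => k) (algebraMap ℂ A k) := by
  simpa only [mul_one, ← Algebra.algebraMap_eq_smul_one] using (one a).const_smul k

theorem id_mul (hb : HasHolFunCalc a f b) : HasHolFunCalc a (fun z => z * f z) (a * b) := by
  obtain ⟨U, hU, haU, hf, h⟩ := hb
  refine ⟨U, hU, haU, differentiableOn_id.mul hf, fun Γ hΓ => ?_⟩
  have hcont := continuousOn_smul_resolvent hΓ hf
  have hsplit : EqOn (fun z => (z * f z) • resolvent a z)
      (fun z => f z • (1 : A) + a * (f z • resolvent a z)) Γ.trace := fun z hz => by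
    simp only
    rw [mul_comm, mul_smul, smul_resolvent (hΓ.1 hz).2, smul_add, mul_smul_comm]
  have hleft : Γ.integral (fun z => a * (f z • resolvent a z)) =
      a * Γ.integral fun z => f z • resolvent a z :=
    integral_clm (ContinuousLinearMap.mul ℂ A a) hcont
  rw [← h Γ hΓ, resolventIntegral, resolventIntegral, integral_congr hsplit,
    integral_add ((hf.continuousOn.mono fun z hz => (hΓ.1 hz).1).fun_smul continuousOn_const)
      (continuousOn_const.fun_mul hcont), PlaneCycle.integral_smul_const, hΓ.integral_eq_zero hU hf,
    zero_smul, zero_add, hleft, mul_smul_comm]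

theorem id (a : A) : HasHolFunCalc a (fun z => z) a := by
  simpa only [mul_one] using (one a).id_mul

theorem sub_mul_dslope {z : ℂ} (hc : HasHolFunCalc a g c) (hb : HasHolFunCalc a (dslope g z) b) :
    (algebraMap ℂ A z - a) * b = algebraMap ℂ A (g z) - c := by
  rw [sub_mul, ← Algebra.smul_def]
  refine ((hb.const_smul z).sub hb.id_mul).unique ((const a (g z)).sub hc)
    (Eventually.of_forall fun w => ?_)
  have h := sub_smul_dslope g z w
  rw [smul_eq_mul] at h
  linear_combination -h

theorem mul (hb : HasHolFunCalc a f b) (hc : HasHolFunCalc a g c) :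
    HasHolFunCalc a (fun z => f z * g z) (b * c) := by
  obtain ⟨U, hU, haU, hf, hg, h⟩ := hb.exists_common hc
  obtain ⟨Γ, hΓ⟩ := exists_surrounds (spectrum.isCompact a) hU haU
  obtain ⟨Γ', hΓ'⟩ := exists_surrounds ((spectrum.isCompact (𝕜 := ℂ) a).union Γ.isCompact_trace) hU
    (union_subset haU (hΓ.1.trans sdiff_subset))
  have haΓ' : Γ'.Surrounds (spectrum ℂ a) U := hΓ'.mono subset_union_left Subset.rfl
  have hslope : EqOn (fun z => (f z * g z) • resolvent a z - f z • resolvent a z * c)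
      (fun z => f z • resolventIntegral a Γ' (dslope g z)) Γ.trace := fun z hz => by
    have hz' := hΓ.1 hz
    have hd := hc.sub_mul_dslope (haΓ'.hasHolFunCalc hU haU
      ((Complex.differentiableOn_dslope (hU.mem_nhds hz'.1)).2 hg))
    have hres : resolventIntegral a Γ' (dslope g z) = g z • resolvent a z - resolvent a z * c := by
      rw [← one_mul (resolventIntegral _ _ _), ← resolvent_mul_sub hz'.2, mul_assoc, hd, mul_sub,
        ← Algebra.commutes, ← Algebra.smul_def]
    simp only [hres, smul_sub, mul_smul, smul_mul_assoc]
  have hzero : Γ.integral (fun z => f z • resolventIntegral a Γ' (dslope g z)) = 0 := by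
    simp only [resolventIntegral, smul_comm _ (_⁻¹ : ℂ), integral_const_smul]
    rw [integral_integral_dslope_eq_zero hΓ hU (haΓ'.1.trans sdiff_subset) ?_ hf hg ?_, smul_zero]
    · exact disjoint_left.2 fun z hz hz' => (hΓ'.1 hz').2 (Or.inr hz)
    · exact (differentiableOn_resolvent a).continuousOn.mono fun _ hz => (haΓ'.1 hz).2
  have hright : Γ.integral (fun z => f z • resolvent a z * c) =
      (Γ.integral fun z => f z • resolvent a z) * c :=
    integral_clm ((ContinuousLinearMap.mul ℂ A).flip c) (continuousOn_smul_resolvent hΓ hf)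
  rw [← integral_congr hslope, integral_sub (continuousOn_smul_resolvent hΓ (hf.fun_mul hg))
    ((continuousOn_smul_resolvent hΓ hf).fun_mul continuousOn_const), hright, sub_eq_zero] at hzero
  convert hΓ.hasHolFunCalc hU haU (hf.fun_mul hg)
  rw [resolventIntegral, hzero, ← (h Γ hΓ).1, resolventIntegral, smul_mul_assoc]

theorem commute (hb : HasHolFunCalc a f b) (hc : HasHolFunCalc a g c) : Commute b c :=
  (hb.mul hc).unique (hc.mul hb) (Eventually.of_forall fun _ => mul_comm _ _)

theorem isUnit (hb : HasHolFunCalc a f b) (hf0 : ∀ z ∈ spectrum ℂ a, f z ≠ 0) : IsUnit b := by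
  have ⟨U, hU, haU, hf, _⟩ := hb
  have hV : IsOpen (U ∩ f ⁻¹' {0}ᶜ) :=
    hf.continuousOn.isOpen_inter_preimage hU isOpen_compl_singleton
  have haV : spectrum ℂ a ⊆ U ∩ f ⁻¹' {0}ᶜ := fun z hz => ⟨haU hz, hf0 z hz⟩
  obtain ⟨c, hc⟩ := exists_hasHolFunCalc (f := fun z => (f z)⁻¹) hV haV
    ((hf.mono inter_subset_left).inv fun z hz => hz.2)
  have hbc : b * c = 1 := (hb.mul hc).unique (one a) (eventually_nhdsSet_iff_exists.2
    ⟨_, hV, haV, fun z hz => mul_inv_cancel₀ hz.2⟩)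
  exact ⟨⟨b, c, hbc, (hb.commute hc).eq ▸ hbc⟩, rfl⟩

theorem spectrum_eq (hb : HasHolFunCalc a f b) : spectrum ℂ b = f '' spectrum ℂ a := by
  refine Subset.antisymm (fun μ hμ => ?_) ?_
  · contrapose! hμ
    exact spectrum.notMem_iff.2 <| ((const a μ).sub hb).isUnit fun z hz h =>
      hμ ⟨z, hz, (sub_eq_zero.1 h).symm⟩
  · rintro _ ⟨z, hz, rfl⟩ hu
    have ⟨U, hU, haU, hf, _⟩ := hb
    obtain ⟨d, hd⟩ := exists_hasHolFunCalc hU haU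
      ((Complex.differentiableOn_dslope (hU.mem_nhds (haU hz))).2 hf)
    rw [spectrum.mem_resolventSet_iff, ← hb.sub_mul_dslope hd] at hu
    exact hz ((((const a z).sub (id a)).commute hd).isUnit_mul_iff.1 hu).1

end HasHolFunCalc

end FunctionalCalculus

/-! ### Spectral sets -/

section SpectralSets

open PlaneCycle

variable {X : Type*} [NormedAddCommGroup X] [NormedSpace ℂ X] {T S : X →L[ℂ] X}
variable {σ K U V₁ V₂ : Set ℂ} {f : ℂ → ℂ} {r : ℂ}

theorem differentiableOn_indicator_union {𝕜 E F : Type*} [NontriviallyNormedField 𝕜]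
    [NormedAddCommGroup E] [NormedSpace 𝕜 E] [NormedAddCommGroup F] [NormedSpace 𝕜 F]
    {s t : Set E} {g : E → F} (hs : IsOpen s) (ht : IsOpen t) (hst : Disjoint s t)
    (hg : DifferentiableOn 𝕜 g s) : DifferentiableOn 𝕜 (s.indicator g) (s ∪ t) :=
  (hg.congr fun _ hz => indicator_of_mem hz g).union_of_isOpen
    ((differentiableOn_const 0).congr fun _ hz => indicator_of_notMem (disjoint_right.1 hst hz) g)
    hs ht

theorem isRieszIntegral_rieszIntegral [CompleteSpace X] (hK : IsCompact K) (hU : IsOpen U)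
    (hKU : K ⊆ U) (hspec : spectrum ℂ T ∩ U ⊆ K) (hf : DifferentiableOn ℂ f U) :
    IsRieszIntegral T K U f (rieszIntegral T K U f) := by
  have h : ∃ A, IsRieszIntegral T K U f A := by
    obtain ⟨Γ, hΓ⟩ := exists_surrounds hK hU hKU
    exact ⟨resolventIntegral T Γ f, ⟨Γ, hΓ⟩, fun Γ' hΓ' =>
      hΓ'.resolventIntegral_eq hΓ hK.isClosed hU hspec hf⟩
  rw [rieszIntegral, dif_pos h]
  exact h.choose_spec

theorem isRieszIntegral_holFunCalc [CompleteSpace X] (hU : IsOpen U) (hTU : spectrum ℂ T ⊆ U)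
    (hf : DifferentiableOn ℂ f U) : IsRieszIntegral T (spectrum ℂ T) U f (holFunCalc T U f) :=
  isRieszIntegral_rieszIntegral (spectrum.isCompact T) hU hTU inter_subset_left hf

theorem hasHolFunCalc_holFunCalc [CompleteSpace X] (hU : IsOpen U) (hTU : spectrum ℂ T ⊆ U)
    (hf : DifferentiableOn ℂ f U) : HasHolFunCalc T f (holFunCalc T U f) :=
  ⟨U, hU, hTU, hf, (isRieszIntegral_holFunCalc hU hTU hf).2⟩

theorem isDrazinInvertible_of_mul_mul_self (hcomm : T * S = S * T) (hS : S * T * S = S) :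
    IsDrazinInvertible S := by
  have hleft : T * S * T * S = T * S := by rw [mul_assoc, mul_assoc, ← mul_assoc S, hS]
  have hright : S * (T * S * T) = S * T := by rw [← mul_assoc, ← mul_assoc, hS]
  refine ⟨T * S * T, hleft.trans (hcomm.trans hright.symm), ?_, 1, ?_⟩
  · rw [hleft, mul_assoc T S (T * S * T), hright, mul_assoc]
  · rw [pow_one, hright, hS]

theorem derivedSet_subset_singleton_of_subset_isoPoints {A : Set ℂ} {a : ℂ} (hσ : IsClosed σ)
    (hσA : σ ⊆ A) (hiso : σ \ {a} ⊆ isoPoints A) : derivedSet σ ⊆ {a} := fun _ hz =>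
  by_contra fun hza => (hiso ⟨(isClosed_iff_derivedSet_subset σ).1 hσ hz, hza⟩).2
    (derivedSet_mono _ _ hσA hz)

theorem derivedSet_image_neg_subset {G : Type*} [TopologicalSpace G] [InvolutiveNeg G]
    [ContinuousNeg G] (s : Set G) :
    derivedSet (Neg.neg '' s) ⊆ Neg.neg '' derivedSet s := fun z hz => by
  have h : AccPt (-z) _ := AccPt.map hz continuous_neg.continuousAt neg_injective
  rw [map_principal, image_image] at h
  simp only [neg_neg, image_id'] at h
  exact ⟨-z, h, neg_neg z⟩

namespace IsSpectralSet

theorem nhdsSet_spectrum (hσ : IsSpectralSet T σ) :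
    𝓝ˢ (spectrum ℂ T) = 𝓝ˢ σ ⊔ 𝓝ˢ (spectrum ℂ T \ σ) := by
  rw [← nhdsSet_union, union_sdiff_cancel hσ.1]

variable [CompleteSpace X]

theorem isCompact (hσ : IsSpectralSet T σ) : IsCompact σ :=
  (spectrum.isCompact T).of_isClosed_subset hσ.2.1 hσ.1

theorem isCompact_sdiff (hσ : IsSpectralSet T σ) : IsCompact (spectrum ℂ T \ σ) :=
  (spectrum.isCompact T).of_isClosed_subset hσ.2.2 sdiff_subset

theorem separatedNhds (hσ : IsSpectralSet T σ) : SeparatedNhds σ (spectrum ℂ T \ σ) :=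
  .of_isCompact_isCompact hσ.isCompact hσ.isCompact_sdiff disjoint_sdiff_self_right

theorem isRieszIntegral_spectralProjection (hσ : IsSpectralSet T σ) :
    IsRieszIntegral T σ (spectrum ℂ T \ σ)ᶜ (fun _ => 1) (spectralProjection T σ) :=
  isRieszIntegral_rieszIntegral hσ.isCompact hσ.2.2.isOpen_compl (fun _ hz hz' => hz'.2 hz)
    (fun _ hz => by_contra fun hzσ => hz.2 ⟨hz.1, hzσ⟩) (differentiableOn_const 1)

theorem hasHolFunCalc_indicator_spectralProjection (hσ : IsSpectralSet T σ) (hV₁ : IsOpen V₁)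
    (hV₂ : IsOpen V₂) (hσV : σ ⊆ V₁) (hσV' : spectrum ℂ T \ σ ⊆ V₂) (hV : Disjoint V₁ V₂) :
    HasHolFunCalc T (V₁.indicator fun _ => 1) (spectralProjection T σ) := by
  obtain ⟨Γ₁, h₁⟩ := exists_surrounds hσ.isCompact hV₁ hσV
  obtain ⟨Γ₂, h₂⟩ := exists_surrounds hσ.isCompact_sdiff hV₂ hσV'
  have hΓ : (Γ₁.append Γ₂).Surrounds (spectrum ℂ T) (V₁ ∪ V₂) :=
    union_sdiff_cancel hσ.1 ▸ h₁.append h₂ hσV hσV' hV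
  have hTV : spectrum ℂ T ⊆ V₁ ∪ V₂ :=
    (union_sdiff_cancel hσ.1).symm.subset.trans (union_subset_union hσV hσV')
  convert hΓ.hasHolFunCalc (hV₁.union hV₂) hTV
    (differentiableOn_indicator_union hV₁ hV₂ hV (differentiableOn_const 1))
  have hone : EqOn (fun z => V₁.indicator (fun _ => (1 : ℂ)) z • resolvent T z)
      (fun z => (1 : ℂ) • resolvent T z) Γ₁.trace := fun z hz => by
    simp only [indicator_of_mem (h₁.1 hz).1]
  have hzero : EqOn (fun z => V₁.indicator (fun _ => (1 : ℂ)) z • resolvent T z)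
      (fun z => (0 : ℂ) • resolvent T z) Γ₂.trace := fun z hz => by
    simp only [indicator_of_notMem (disjoint_right.1 hV (h₂.1 hz).1)]
  have hV₁σ : V₁ ⊆ (spectrum ℂ T \ σ)ᶜ := fun z hz hz' => disjoint_left.1 hV hz (hσV' hz')
  rw [resolventIntegral, integral_append, integral_congr hone, integral_congr hzero,
    integral_const_smul (0 : ℂ), zero_smul, add_zero]
  exact (hσ.isRieszIntegral_spectralProjection.2 Γ₁ (h₁.mono Subset.rfl hV₁σ)).symm

theorem exists_hasHolFunCalc_spectralProjection (hσ : IsSpectralSet T σ) :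
    ∃ χ, HasHolFunCalc T χ (spectralProjection T σ) ∧ (∀ᶠ z in 𝓝ˢ σ, χ z = 1) ∧
      ∀ᶠ z in 𝓝ˢ (spectrum ℂ T \ σ), χ z = 0 := by
  obtain ⟨V₁, V₂, hV₁, hV₂, hσV, hσV', hV⟩ := hσ.separatedNhds
  exact ⟨_, hσ.hasHolFunCalc_indicator_spectralProjection hV₁ hV₂ hσV hσV' hV,
    eventually_nhdsSet_iff_exists.2 ⟨V₁, hV₁, hσV, fun _ hz => indicator_of_mem hz _⟩,
    eventually_nhdsSet_iff_exists.2 ⟨V₂, hV₂, hσV', fun _ hz =>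
      indicator_of_notMem (disjoint_right.1 hV hz) _⟩⟩

theorem isUnit_add_smul_spectralProjection (hσ : IsSpectralSet T σ)
    (h0 : (0 : ℂ) ∉ spectrum ℂ T \ σ) (hr : -r ∉ σ) : IsUnit (T + r • spectralProjection T σ) := by
  obtain ⟨χ, hχ, hχσ, hχσ'⟩ := hσ.exists_hasHolFunCalc_spectralProjection
  refine ((HasHolFunCalc.id T).add (hχ.const_smul r)).isUnit fun z hz hz0 => ?_
  by_cases hzσ : z ∈ σ
  · rw [hχσ.self_of_nhdsSet z hzσ, mul_one] at hz0
    exact hr (eq_neg_of_add_eq_zero_left hz0 ▸ hzσ)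
  · rw [hχσ'.self_of_nhdsSet z ⟨hz, hzσ⟩, mul_zero, add_zero] at hz0
    exact h0 (hz0 ▸ ⟨hz, hzσ⟩)

theorem exists_isReciprocalOff (hσ : IsSpectralSet T σ) (h0 : (0 : ℂ) ∉ spectrum ℂ T \ σ) :
    ∃ U f, IsReciprocalOff T σ U f := by
  obtain ⟨V₁, V₂, hV₁, hV₂, hσV, hσV', hV⟩ := hσ.separatedNhds
  have hV₂0 : IsOpen (V₂ ∩ {0}ᶜ) := hV₂.inter isOpen_compl_singleton
  have hσV0 : spectrum ℂ T \ σ ⊆ V₂ ∩ {0}ᶜ := subset_inter hσV' (subset_compl_singleton_iff.2 h0)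
  have hdisj : Disjoint (V₂ ∩ {0}ᶜ) V₁ := hV.symm.mono_left inter_subset_left
  refine ⟨V₂ ∩ {0}ᶜ ∪ V₁, (V₂ ∩ {0}ᶜ).indicator fun z => 1 / z, hV₂0.union hV₁, ?_, ?_, ?_, ?_⟩
  · rw [← sdiff_union_of_subset hσ.1]
    exact union_subset_union hσV0 hσV
  · exact differentiableOn_indicator_union hV₂0 hV₁ hdisj
      ((differentiableOn_const 1).fun_div differentiableOn_id fun z hz => hz.2)
  · exact eventually_nhdsSet_iff_exists.2 ⟨V₁, hV₁, hσV, fun _ hz =>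
      indicator_of_notMem (disjoint_right.1 hdisj hz) _⟩
  · exact eventually_nhdsSet_iff_exists.2 ⟨_, hV₂0, hσV0, fun _ hz => indicator_of_mem hz _⟩

end IsSpectralSet

namespace IsReciprocalOff

theorem image_spectrum (hf : IsReciprocalOff T σ U f) (hσ : IsSpectralSet T σ)
    (hne : σ.Nonempty) :
    f '' spectrum ℂ T = {0} ∪ {w : ℂ | ∃ z ∈ spectrum ℂ T \ σ, w = z⁻¹} := by
  obtain ⟨-, -, -, hfσ, hfσ'⟩ := hf
  have hzero : f '' σ = {0} := by
    rw [image_congr fun z hz => hfσ.self_of_nhdsSet z hz, hne.image_const]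
  have hinv : f '' (spectrum ℂ T \ σ) = {w : ℂ | ∃ z ∈ spectrum ℂ T \ σ, w = z⁻¹} := by
    rw [image_congr fun z hz => hfσ'.self_of_nhdsSet z hz]
    ext w
    simp only [mem_image, mem_ofPred_eq, one_div, eq_comm]
  rw [← hzero, ← hinv, ← image_union, union_sdiff_cancel hσ.1]

variable [CompleteSpace X]

theorem spectralGzInverse_eq_holFunCalc (hf : IsReciprocalOff T σ U f) (hσ : IsSpectralSet T σ)
    (h0 : (0 : ℂ) ∉ spectrum ℂ T \ σ) (hr : -r ∉ σ) :
    spectralGzInverse T σ r = holFunCalc T U f := by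
  obtain ⟨hU, hTU, hfU, hfσ, hfσ'⟩ := hf
  obtain ⟨χ, hχ, hχσ, hχσ'⟩ := hσ.exists_hasHolFunCalc_spectralProjection
  have hne : ∀ᶠ z in 𝓝ˢ (spectrum ℂ T \ σ), z ≠ 0 :=
    isOpen_compl_singleton.mem_nhdsSet.2 (subset_compl_singleton_iff.2 h0)
  have hmul : (T + r • spectralProjection T σ) * holFunCalc T U f = 1 - spectralProjection T σ := by
    refine (((HasHolFunCalc.id T).add (hχ.const_smul r)).mul
      (hasHolFunCalc_holFunCalc hU hTU hfU)).unique ((HasHolFunCalc.one T).sub hχ) ?_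
    rw [hσ.nhdsSet_spectrum, EventuallyEq, eventually_sup]
    constructor
    · filter_upwards [hfσ, hχσ] with z hfz hχz
      rw [hfz, hχz, mul_zero, sub_self]
    · filter_upwards [hfσ', hχσ', hne] with z hfz hχz hz
      rw [hfz, hχz, mul_zero, add_zero, mul_one_div_cancel hz, sub_zero]
  rw [spectralGzInverse, ← hmul,
    Ring.inverse_mul_cancel_left _ _ (hσ.isUnit_add_smul_spectralProjection h0 hr)]

theorem mul_mul_self (hf : IsReciprocalOff T σ U f) (hσ : IsSpectralSet T σ)
    (hS : HasHolFunCalc T f S) : S * T * S = S := by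
  obtain ⟨-, -, -, hfσ, hfσ'⟩ := hf
  refine ((hS.mul (.id T)).mul hS).unique hS ?_
  rw [hσ.nhdsSet_spectrum, EventuallyEq, eventually_sup]
  constructor
  · filter_upwards [hfσ] with z hfz
    rw [hfz, mul_zero]
  · filter_upwards [hfσ'] with z hfz
    simpa only [hfz, one_div, inv_inv] using mul_inv_mul_cancel z⁻¹

theorem spectrum_sq_mul_sub_subset (hf : IsReciprocalOff T σ U f) (hS : HasHolFunCalc T f S) :
    spectrum ℂ (T ^ 2 * S - T) ⊆ Neg.neg '' (σ ∪ {0}) := by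
  obtain ⟨-, -, -, hfσ, hfσ'⟩ := hf
  have hfun : HasHolFunCalc T (fun z => z * (z * f z) - z) (T ^ 2 * S - T) := by
    rw [sq, mul_assoc]
    exact hS.id_mul.id_mul.sub (.id T)
  rw [hfun.spectrum_eq]
  rintro _ ⟨z, hz, rfl⟩
  by_cases hzσ : z ∈ σ
  · refine ⟨z, Or.inl hzσ, ?_⟩
    simp only [hfσ.self_of_nhdsSet z hzσ, mul_zero, zero_sub]
  · refine ⟨0, Or.inr rfl, ?_⟩
    simp only [hfσ'.self_of_nhdsSet z ⟨hz, hzσ⟩, one_div, ← mul_assoc, mul_self_mul_inv, sub_self,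
      neg_zero]

theorem isGzInverse (hf : IsReciprocalOff T σ U f) (hσ : IsSpectralSet T σ)
    (hiso : σ \ {0} ⊆ isoPoints (spectrum ℂ T)) (hS : HasHolFunCalc T f S) : IsGzInverse T S := by
  have hcomm : T * S = S * T := (HasHolFunCalc.id T).commute hS
  have hSTS : S * T * S = S := hf.mul_mul_self hσ hS
  refine ⟨isDrazinInvertible_of_mul_mul_self hcomm hSTS, hcomm, hSTS, ?_⟩
  have hσ0 : derivedSet (σ ∪ {0}) ⊆ {0} := by
    rw [derivedSet_union]
    exact union_subset (derivedSet_subset_singleton_of_subset_isoPoints hσ.2.1 hσ.1 hiso)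
      ((isClosed_iff_derivedSet_subset _).1 isClosed_singleton)
  calc derivedSet (spectrum ℂ (T ^ 2 * S - T))
      ⊆ derivedSet (Neg.neg '' (σ ∪ {0})) := derivedSet_mono _ _ (hf.spectrum_sq_mul_sub_subset hS)
    _ ⊆ Neg.neg '' derivedSet (σ ∪ {0}) := derivedSet_image_neg_subset _
    _ ⊆ Neg.neg '' {0} := image_mono hσ0
    _ = {0} := by rw [image_singleton, neg_zero]

end IsReciprocalOff

end SpectralSets

end

theorem mainTheorem6_general {X : Type*} [NormedAddCommGroup X] [NormedSpace ℂ X] [CompleteSpace X]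
    (T : X →L[ℂ] X) (σ : Set ℂ) (hσ : IsSpectralSet T σ) (hne : σ.Nonempty)
    (h0 : (0 : ℂ) ∉ spectrum ℂ T \ σ) (hiso : σ \ {0} ⊆ isoPoints (spectrum ℂ T))
    (r : ℂ) (hr : -r ∉ σ) :
    IsRieszIntegral T σ (spectrum ℂ T \ σ)ᶜ (fun _ => 1) (spectralProjection T σ) ∧
    IsUnit (T + r • spectralProjection T σ) ∧
    IsGzInverse T (spectralGzInverse T σ r) ∧
    (∃ (U : Set ℂ) (f : ℂ → ℂ), IsReciprocalOff T σ U f) ∧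
    (∀ (U : Set ℂ) (f : ℂ → ℂ), IsReciprocalOff T σ U f →
      IsRieszIntegral T (spectrum ℂ T) U f (holFunCalc T U f) ∧
      spectralGzInverse T σ r = holFunCalc T U f) ∧
    spectrum ℂ (spectralGzInverse T σ r) =
      {0} ∪ {w : ℂ | ∃ z ∈ spectrum ℂ T \ σ, w = z⁻¹} := by
  obtain ⟨U, f, hf⟩ := hσ.exists_isReciprocalOff h0
  have hS : HasHolFunCalc T f (spectralGzInverse T σ r) := by
    rw [hf.spectralGzInverse_eq_holFunCalc hσ h0 hr]
    exact hasHolFunCalc_holFunCalc hf.1 hf.2.1 hf.2.2.1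
  exact ⟨hσ.isRieszIntegral_spectralProjection, hσ.isUnit_add_smul_spectralProjection h0 hr,
    hf.isGzInverse hσ hiso hS, ⟨U, f, hf⟩,
    fun V g hg => ⟨isRieszIntegral_holFunCalc hg.1 hg.2.1 hg.2.2.1,
      hg.spectralGzInverse_eq_holFunCalc hσ h0 hr⟩,
    hS.spectrum_eq.trans (hf.image_spectrum hσ hne)⟩

theorem mainTheorem6 {X : Type*} [NormedAddCommGroup X] [NormedSpace ℂ X] [CompleteSpace X]
    (T : X →L[ℂ] X) (hT : (0 : ℂ) ∈ spectrum ℂ T \ derivedSet (derivedSet (spectrum ℂ T)))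
    (σ : Set ℂ) (hσ : IsSpectralSet T σ) (h0 : (0 : ℂ) ∈ σ)
    (hiso : σ \ {0} ⊆ isoPoints (spectrum ℂ T))
    (r : ℂ) (hr : ∀ z ∈ σ, ‖z‖ < ‖r‖) :
    -- the operator `T^D_σ = (T + r P_σ)⁻¹ (I - P_σ)` is well defined, and it is a `g_z`-inverse
    IsRieszIntegral T σ (spectrum ℂ T \ σ)ᶜ (fun _ => 1) (spectralProjection T σ) ∧
    IsUnit (T + r • spectralProjection T σ) ∧
    IsGzInverse T (spectralGzInverse T σ r) ∧
    -- functions `f_σ` exist, and for each of them `f_σ(T)` is well defined and equal to `T^D_σ`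
    (∃ (U : Set ℂ) (f : ℂ → ℂ), IsReciprocalOff T σ U f) ∧
    (∀ (U : Set ℂ) (f : ℂ → ℂ), IsReciprocalOff T σ U f →
      IsRieszIntegral T (spectrum ℂ T) U f (holFunCalc T U f) ∧
      spectralGzInverse T σ r = holFunCalc T U f) ∧
    -- the spectrum of `T^D_σ`
    spectrum ℂ (spectralGzInverse T σ r) =
      {0} ∪ {w : ℂ | ∃ z ∈ spectrum ℂ T \ σ, w = z⁻¹} := by
  refine mainTheorem6_general T σ hσ ⟨0, h0⟩ (fun h => h.2 h0) hiso r fun hrσ => ?_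
  exact (hr _ hrσ).ne (norm_neg r)
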